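/- Consider the min-max regret multi-representative selection problem with budgeted uncertainty. An instance consists of $n$ items, a partition $T_1\cup\dots\cup T_L=[n]$ into nonempty sets, integers $0\le p_\ell\le|T_\ell|$ for $\ell\in[L]$, base costs $\hat c_i\ge 0$ and deviations $d_i\ge 0$ (real numbers) for $i\in[n]$, and a budget $\Gamma\in\{0,1,2,\dots\}$. Let $$\mathcal X=\Big\{x\in\{0,1\}^n:\ \sum_{i\in T_\ell}x_i=p_\ell\ \text{ for all }\ell\in[L]\Big\},$$ $$\mathcal U(\Gamma)=\Big\{c\in\mathbb R^n:\ c_i=\hat c_i+d_i\delta_i\ \text{ for all } i\in[n],\ \delta\in\{0,1\}^n,\ \sum_{i\in[n]}\delta_i\le\Gamma\Big\}.$$ The problem is to solve $$\min_{x\in\mathcal X}\ \max_{c\in\mathcal U(\Gamma)}\Big(c^{t}x-\min_{y\in\mathcal X}c^{t}y\Big).$$ **Theorem.** This problem can be solved in time $O(n^5)$: there is a single program for a random access machine, in which each memory access and each addition, subtraction or comparison (of natural numbers or of real numbers) takes one step, that for every instance with $n$ items halts after at most $O(n^5)$ steps and returns an optimal solution $x\in\mathcal X$ together with the optimal objective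 value. The constant in $O(n^5)$ is absolute; in particular it does not depend on $L$, $p$, $\hat c$, $d$ or $\Gamma$. -/

import Mathlib

open Filter Asymptotics

/-! ### Random access machine with unit-cost steps

The memory consists of arrays of natural numbers and of arrays of real numbers, with unbounded index
range. A program is a fixed finite text, so it names finitely many arrays, while the index of an
accessed cell is computed at run time. The only arithmetic is addition, subtraction and comparison.
In particular there is no multiplication, no rounding, no real constant but `0`, and no passage
between natural and real numbers. -/

namespace RAM

/-- Contents of the memory: `nat a i` and `real a i` are the cells with index `i` of array `a`. -/
structure Store where
  nat : ℕ → ℕ → ℕ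
  real : ℕ → ℕ → ℝ

/-- Write `v` into cell `i` of the array `a` of natural numbers. -/
def Store.writeNat (s : Store) (a i v : ℕ) : Store :=
  { s with nat := Function.update s.nat a (Function.update (s.nat a) i v) }

/-- Write `v` into cell `i` of the array `a` of real numbers. -/
noncomputable def Store.writeReal (s : Store) (a i : ℕ) (v : ℝ) : Store :=
  { s with real := Function.update s.real a (Function.update (s.real a) i v) }

/-- Natural number expressions. Subtraction is truncated at `0`. -/
inductive NatExpr where
  | const (k : ℕ)
  | load (a : ℕ) (i : NatExpr)
  | add (e f : NatExpr)
  | sub (e f : NatExpr)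

/-- Value of an expression. -/
def NatExpr.eval (s : Store) : NatExpr → ℕ
  | .const k => k
  | .load a i => s.nat a (i.eval s)
  | .add e f => e.eval s + f.eval s
  | .sub e f => e.eval s - f.eval s

/-- Number of steps of an evaluation: one for each constant, memory access and operation. -/
def NatExpr.cost : NatExpr → ℕ
  | .const _ => 1
  | .load _ i => i.cost + 1
  | .add e f => e.cost + f.cost + 1
  | .sub e f => e.cost + f.cost + 1

/-- Real number expressions. -/
inductive RealExpr where
  | zero
  | load (a : ℕ) (i : NatExpr)
  | add (e f : RealExpr)
  | sub (e f : RealExpr)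

/-- Value of an expression. -/
noncomputable def RealExpr.eval (s : Store) : RealExpr → ℝ
  | .zero => 0
  | .load a i => s.real a (i.eval s)
  | .add e f => e.eval s + f.eval s
  | .sub e f => e.eval s - f.eval s

/-- Number of steps of an evaluation: one for each constant, memory access and operation. -/
def RealExpr.cost : RealExpr → ℕ
  | .zero => 1
  | .load _ i => i.cost + 1
  | .add e f => e.cost + f.cost + 1
  | .sub e f => e.cost + f.cost + 1

/-- Comparisons. -/
inductive Test where
  | natLe (e f : NatExpr)
  | realLe (e f : RealExpr)

/-- Outcome of a comparison. -/
def Test.Holds (s : Store) : Test → Prop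
  | .natLe e f => e.eval s ≤ f.eval s
  | .realLe e f => e.eval s ≤ f.eval s

/-- Number of steps of a comparison. -/
def Test.cost : Test → ℕ
  | .natLe e f => e.cost + f.cost + 1
  | .realLe e f => e.cost + f.cost + 1

/-- Programs: `setNat a i e` and `setReal a i e` store the value of `e` in cell `i` of array `a`,
`branch b c c'` is "if `b` then `c` else `c'`", and `loop b c` is "while `b` do `c`". -/
inductive Program where
  | skip
  | setNat (a : ℕ) (i e : NatExpr)
  | setReal (a : ℕ) (i : NatExpr) (e : RealExpr)
  | seq (c c' : Program)
  | branch (b : Test) (c c' : Program)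
  | loop (b : Test) (c : Program)

/-- `Exec c s s' t`: started on the memory `s`, the program `c` halts after exactly `t` steps and
leaves the memory `s'`. -/
inductive Exec : Program → Store → Store → ℕ → Prop where
  | skip (s : Store) : Exec .skip s s 1
  | setNat (s : Store) (a : ℕ) (i e : NatExpr) :
      Exec (.setNat a i e) s (s.writeNat a (i.eval s) (e.eval s)) (i.cost + e.cost + 1)
  | setReal (s : Store) (a : ℕ) (i : NatExpr) (e : RealExpr) :
      Exec (.setReal a i e) s (s.writeReal a (i.eval s) (e.eval s)) (i.cost + e.cost + 1)
  | seq {c c' : Program} {s s' s'' : Store} {t t' : ℕ} :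
      Exec c s s' t → Exec c' s' s'' t' → Exec (.seq c c') s s'' (t + t')
  | branch_true {b : Test} {c c' : Program} {s s' : Store} {t : ℕ} :
      b.Holds s → Exec c s s' t → Exec (.branch b c c') s s' (b.cost + t)
  | branch_false {b : Test} {c c' : Program} {s s' : Store} {t : ℕ} :
      ¬ b.Holds s → Exec c' s s' t → Exec (.branch b c c') s s' (b.cost + t)
  | loop_true {b : Test} {c : Program} {s s' s'' : Store} {t t' : ℕ} :
      b.Holds s → Exec c s s' t → Exec (.loop b c) s' s'' t' →
        Exec (.loop b c) s s'' (b.cost + t + t')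
  | loop_false {b : Test} {c : Program} {s : Store} :
      ¬ b.Holds s → Exec (.loop b c) s s b.cost

/-- Programs are deterministic, in their result and in their number of steps. -/
theorem Exec.deterministic {c : Program} {s s₁ : Store} {t₁ : ℕ} (h : Exec c s s₁ t₁) :
    ∀ {s₂ : Store} {t₂ : ℕ}, Exec c s s₂ t₂ → s₁ = s₂ ∧ t₁ = t₂ := by
  induction h with
  | skip s => intro s₂ t₂ h'; cases h'; exact ⟨rfl, rfl⟩
  | setNat s a i e => intro s₂ t₂ h'; cases h'; exact ⟨rfl, rfl⟩
  | setReal s a i e => intro s₂ t₂ h'; cases h'; exact ⟨rfl, rfl⟩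
  | seq _ _ ih ih' =>
    intro s₂ t₂ h'
    cases h' with
    | seq k k' =>
      obtain ⟨rfl, rfl⟩ := ih k
      obtain ⟨rfl, rfl⟩ := ih' k'
      exact ⟨rfl, rfl⟩
  | branch_true hb _ ih =>
    intro s₂ t₂ h'
    cases h' with
    | branch_true _ k => obtain ⟨rfl, rfl⟩ := ih k; exact ⟨rfl, rfl⟩
    | branch_false hb' _ => exact absurd hb hb'
  | branch_false hb _ ih =>
    intro s₂ t₂ h'
    cases h' with
    | branch_true hb' _ => exact absurd hb' hb
    | branch_false _ k => obtain ⟨rfl, rfl⟩ := ih k; exact ⟨rfl, rfl⟩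
  | loop_true hb _ _ ih ih' =>
    intro s₂ t₂ h'
    cases h' with
    | loop_true _ k k' =>
      obtain ⟨rfl, rfl⟩ := ih k
      obtain ⟨rfl, rfl⟩ := ih' k'
      exact ⟨rfl, rfl⟩
    | loop_false hb' => exact absurd hb hb'
  | loop_false hb =>
    intro s₂ t₂ h'
    cases h' with
    | loop_true hb' _ _ => exact absurd hb' hb
    | loop_false _ => exact ⟨rfl, rfl⟩

end RAM

/-! ### Min-max regret multi-representative selection with budgeted uncertainty -/

/-- An instance with `n` items. The items are partitioned into the `L` nonempty sets
`T ℓ = {i | part i = ℓ}`; item `i` has base cost `base i` and deviation `dev i`; at most `budget`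
items deviate simultaneously. -/
structure SelectionInstance (n : ℕ) where
  L : ℕ
  part : Fin n → Fin L
  part_surjective : Function.Surjective part
  p : Fin L → ℕ
  p_le : ∀ ℓ, p ℓ ≤ (Finset.univ.filter fun i => part i = ℓ).card
  base : Fin n → ℝ
  base_nonneg : ∀ i, 0 ≤ base i
  dev : Fin n → ℝ
  dev_nonneg : ∀ i, 0 ≤ dev i
  budget : ℕ

namespace SelectionInstance

variable {n : ℕ} (I : SelectionInstance n)

/-- The set `T ℓ` of the partition of the items. -/
def T (ℓ : Fin I.L) : Finset (Fin n) := Finset.univ.filter fun i => I.part i = ℓ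

/-- The feasible solutions: vectors in `{0,1}ⁿ` with exactly `p ℓ` items of each `T ℓ`. -/
def feasible : Set (Fin n → ℝ) :=
  {x | (∀ i, x i = 0 ∨ x i = 1) ∧ ∀ ℓ, ∑ i ∈ I.T ℓ, x i = I.p ℓ}

/-- The deviations `δ ∈ {0,1}ⁿ` with at most `budget` ones. -/
def deviations : Set (Fin n → ℝ) :=
  {δ | (∀ i, δ i = 0 ∨ δ i = 1) ∧ ∑ i, δ i ≤ I.budget}

/-- The budgeted uncertainty set. -/
def scenarios : Set (Fin n → ℝ) :=
  {c | ∃ δ ∈ I.deviations, ∀ i, c i = I.base i + I.dev i * δ i}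

/-- `m` is the optimal value of the nominal problem with costs `c`. -/
def IsNominalValue (c : Fin n → ℝ) (m : ℝ) : Prop :=
  IsLeast ((fun y => ∑ i, c i * y i) '' I.feasible) m

/-- `r` is the maximum regret of `x`, that is, the maximum over all scenarios `c` of the cost of `x`
minus the optimal value of the nominal problem with costs `c`. -/
def IsMaxRegret (x : Fin n → ℝ) (r : ℝ) : Prop :=
  IsGreatest {w | ∃ c ∈ I.scenarios, ∃ m, I.IsNominalValue c m ∧ w = ∑ i, c i * x i - m} r

/-- `x` is an optimal solution, with objective value `r`, of the min-max regret problem. -/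
def IsMinMaxRegret (x : Fin n → ℝ) (r : ℝ) : Prop :=
  x ∈ I.feasible ∧ I.IsMaxRegret x r ∧ IsLeast {w | ∃ z ∈ I.feasible, I.IsMaxRegret z w} r

/-- The initial memory. The first array of natural numbers holds `n`, the number of sets and the
budget, the next one holds for each item the index of its set, and the one after that the numbers
`p`. The first two arrays of real numbers hold the base costs and the deviations. All other cells are
`0`. -/
noncomputable def input : RAM.Store where
  nat a i :=
    match a with
    | 0 => if i = 0 then n else if i = 1 then I.L else if i = 2 then I.budget else 0
    | 1 => if h : i < n then I.part ⟨i, h⟩ else 0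
    | 2 => if h : i < I.L then I.p ⟨i, h⟩ else 0
    | _ => 0
  real a i :=
    match a with
    | 0 => if h : i < n then I.base ⟨i, h⟩ else 0
    | 1 => if h : i < n then I.dev ⟨i, h⟩ else 0
    | _ => 0

end SelectionInstance

/-- The vector that a final memory holds as output: the first `n` cells of the array `3` of natural
numbers. -/
def outputSolution (n : ℕ) (s : RAM.Store) : Fin n → ℝ := fun i => s.nat 3 i

/-- The value that a final memory holds as output: the first cell of the array `2` of real numbers. -/
def outputValue (s : RAM.Store) : ℝ := s.real 2 0

/-! For a fixed `x` the adversary chooses `y` and `δ`, and a deviation pays only on items with `x i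
= 1` and `y i = 0`. This problem has an exact linear programming dual, with a price `q ≥ 0` for the
budget and a price `a ℓ` for the cardinality constraint of each set; its objective is `dualValue`.
Weak duality (`regret_le_dualValue`) is an itemwise estimate. Strong duality (`exists_dualValue_eq`)
is proved by exchange arguments: from a best response of the adversary, `q` is read off as the
largest gain from one more unit of budget, each `a ℓ` as a threshold on effective costs, and
complementary slackness gives equality.

The prices found this way lie in finite sets that do not depend on `x`: `q` is `0` or the positive
part of some `d_i + c_i - c_j`, and `a ℓ` is `c_i` or `c_i + max 0 (d_i - q)` for an item `i` of the
set. The min-max regret problem thus becomes a joint minimization of `dualValue` over `q`, `a` and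
`x` (`isMinMaxRegret_of_forall_dualValue_le`). For fixed `q` it splits over the sets, and for fixed
`a ℓ` the contribution of a set is linear in the 0-1 vector `x`, so selecting the `p ℓ` items of
least key is optimal (`sum_key_le`).

There are `O(n²)` budget prices, for each of them `2n` pairs of a set and a price, and repeated
minimum search handles such a pair in `O(n²)` steps: `O(n⁵)` in total. Products such as `γ * q` are
formed by repeated addition; cutting the budget at `n` changes nothing, since at most `n` items
deviate, and makes this cheap. -/

namespace SelectionInstance

/-! ### The dual objective and weak duality -/

variable {n : ℕ} (I : SelectionInstance n)

/-- The budget, cut at the number of items. -/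
def effBudget : ℕ := min I.budget n

/-- Objective value of the dual of the linear program that computes the maximum regret of `x`. -/
noncomputable def dualValue (q : ℝ) (a : Fin I.L → ℝ) (x : Fin n → ℝ) : ℝ :=
  I.effBudget * q
    + ∑ i, (I.base i * x i + max (max 0 (a (I.part i) - I.base i)) (x i * (I.dev i - q)))
    - ∑ ℓ, I.p ℓ * a ℓ

theorem sum_part_mul (a : Fin I.L → ℝ) (y : Fin n → ℝ) :
    ∑ i, a (I.part i) * y i = ∑ ℓ, (∑ i ∈ I.T ℓ, y i) * a ℓ := by
  rw [← Finset.sum_fiberwise Finset.univ I.part]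
  refine Finset.sum_congr rfl fun ℓ _ => ?_
  rw [T, Finset.sum_mul]
  refine Finset.sum_congr rfl fun i hi => ?_
  rw [(Finset.mem_filter.1 hi).2, mul_comm]

theorem sum_deviation_le {δ : Fin n → ℝ} (hδ : δ ∈ I.deviations) : ∑ i, δ i ≤ I.effBudget := by
  have : ∑ i, δ i ≤ n := by
    calc ∑ i, δ i ≤ ∑ _i : Fin n, (1 : ℝ) :=
          Finset.sum_le_sum fun i _ => by rcases hδ.1 i with h | h <;> simp [h]
      _ = n := by simp
  rw [effBudget, Nat.cast_min]
  exact le_min hδ.2 this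

/-- Weak duality. -/
theorem regret_le_dualValue {q : ℝ} (hq : 0 ≤ q) (a : Fin I.L → ℝ) {x y δ : Fin n → ℝ}
    (hx : x ∈ I.feasible) (hy : y ∈ I.feasible) (hδ : δ ∈ I.deviations) :
    ∑ i, (I.base i + I.dev i * δ i) * x i - ∑ i, (I.base i + I.dev i * δ i) * y i
      ≤ I.dualValue q a x := by
  -- The maximum dominates each of its three arguments, and one of them suffices for each 0-1 choice
  -- of `x i`, `y i`, `δ i`. In the sum, the `a`-terms become `∑ p ℓ * a ℓ` because `y` is feasible,
  -- and the `q`-terms are at most the effective budget times `q`.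
  have item : ∀ i, (I.base i + I.dev i * δ i) * x i - (I.base i + I.dev i * δ i) * y i ≤
      (I.base i * x i + max (max 0 (a (I.part i) - I.base i)) (x i * (I.dev i - q)))
        - a (I.part i) * y i + q * δ i := by
    intro i
    have h1 := le_max_left (max 0 (a (I.part i) - I.base i)) (x i * (I.dev i - q))
    have h2 := le_max_right (max 0 (a (I.part i) - I.base i)) (x i * (I.dev i - q))
    have h3 := (le_max_left 0 (a (I.part i) - I.base i)).trans h1
    have h4 := (le_max_right 0 (a (I.part i) - I.base i)).trans h1
    have hd := I.dev_nonneg i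
    rcases hx.1 i with e1 | e1 <;> rcases hy.1 i with e2 | e2 <;> rcases hδ.1 i with e3 | e3 <;>
      rw [e1] at h1 h2 h3 h4 ⊢ <;> rw [e2, e3] <;> linarith
  have := Finset.sum_le_sum fun i (_ : i ∈ Finset.univ) => item i
  rw [Finset.sum_add_distrib, Finset.sum_sub_distrib, Finset.sum_sub_distrib, sum_part_mul,
    ← Finset.mul_sum] at this
  simp only [hy.2] at this
  have h5 := mul_le_mul_of_nonneg_left (I.sum_deviation_le hδ) hq
  rw [dualValue]
  linarith

/-! ### Exchange arguments for the adversary's best response -/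

/-- Change the values of `s` as told by the list `M`. -/
def exchange {α β : Type*} [DecidableEq α] (s : α → β) (M : List (α × β)) : α → β :=
  M.foldr (fun m s => Function.update s m.1 m.2) s

theorem exchange_of_notMem {α β : Type*} [DecidableEq α] (s : α → β) {M : List (α × β)} {a : α}
    (h : a ∉ M.map Prod.fst) : exchange s M a = s a := by
  induction M with
  | nil => rfl
  | cons m M ih =>
    simp only [List.map_cons, List.mem_cons, not_or] at h
    rw [exchange, List.foldr_cons, Function.update_of_ne h.1]
    exact ih h.2

theorem exchange_eq_or_mem {α β : Type*} [DecidableEq α] (s : α → β) (M : List (α × β)) (a : α) :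
    exchange s M a = s a ∨ (a, exchange s M a) ∈ M := by
  induction M with
  | nil => exact .inl rfl
  | cons m M ih =>
    by_cases h : a = m.1
    · subst h; right; simp [exchange]
    · rw [exchange, List.foldr_cons, Function.update_of_ne h]
      exact ih.imp id (List.mem_cons_of_mem _)

/-- Since no item is listed twice, the item at the head still has its old state after the exchanges
of the tail, so the changes add up. -/
theorem sum_exchange {α β : Type*} [DecidableEq α] [Fintype α] (φ : α → β → ℝ) (s : α → β)
    {M : List (α × β)} (hM : (M.map Prod.fst).Nodup) :
    ∑ i, φ i (exchange s M i) =
      ∑ i, φ i (s i) + (M.map fun m => φ m.1 m.2 - φ m.1 (s m.1)).sum := by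
  induction M with
  | nil => simp [exchange]
  | cons m M ih =>
    simp only [List.map_cons, List.nodup_cons] at hM
    have h : ∀ i, φ i (exchange s (m :: M) i) =
        φ i (exchange s M i) + if i = m.1 then φ m.1 m.2 - φ m.1 (s m.1) else 0 := by
      intro i
      rw [exchange, List.foldr_cons]
      by_cases hi : i = m.1
      · subst hi
        rw [exchange_of_notMem s hM.1]; simp
      · rw [Function.update_of_ne hi, if_neg hi, add_zero]; rfl
    simp only [h, Finset.sum_add_distrib, ih hM.2, Finset.sum_ite_eq', Finset.mem_univ, if_true,
      List.map_cons, List.sum_cons]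
    ring

/-! The adversary puts each item into one of three states: `0` if his solution contains it, `1` if
it deviates, `2` otherwise. -/

/-- Contribution of an item to the adversary's gain. -/
def stateGain (i : Fin n) (t : Fin 3) : ℝ :=
  if t = 0 then - I.base i else if t = 1 then I.dev i else 0

/-- Contribution of an item to the size of the adversary's solution within the set `ℓ`. -/
def stateCount (ℓ : Fin I.L) (i : Fin n) (t : Fin 3) : ℝ :=
  if t = 0 ∧ I.part i = ℓ then 1 else 0

/-- Contribution of an item to the number of deviations. -/
def stateDev (_i : Fin n) (t : Fin 3) : ℝ := if t = 1 then 1 else 0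

/-- Feasibility of the adversary's states against `x`. -/
structure IsResponse (x : Fin n → ℝ) (s : Fin n → Fin 3) : Prop where
  count : ∀ ℓ, ∑ i, I.stateCount ℓ i (s i) = I.p ℓ
  selected : ∀ i, s i = 1 → x i = 1
  dev_le : ∑ i, stateDev i (s i) ≤ I.effBudget

/-- Optimality of the adversary's states against `x`. -/
structure IsBestResponse (x : Fin n → ℝ) (s : Fin n → Fin 3) : Prop extends I.IsResponse x s where
  best : ∀ s', I.IsResponse x s' → ∑ i, I.stateGain i (s' i) ≤ ∑ i, I.stateGain i (s i)

theorem exists_isBestResponse {x : Fin n → ℝ} (hx : x ∈ I.feasible) :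
    ∃ s, I.IsBestResponse x s := by
  classical
  -- The adversary can always copy `x` and let nothing deviate.
  have h0 : I.IsResponse x fun i => if x i = 1 then 0 else 2 := by
    refine ⟨fun ℓ => ?_, fun i hi => ?_, ?_⟩
    · rw [← hx.2 ℓ, T, Finset.sum_filter]
      refine Finset.sum_congr rfl fun i _ => ?_
      rcases hx.1 i with h | h <;> simp [stateCount, h]
    · by_contra h; simp [h] at hi
    · have : ∀ i, stateDev i (if x i = 1 then 0 else 2) = 0 := by
        intro i; by_cases h : x i = 1 <;> simp [stateDev, h]
      simp [this]
  obtain ⟨s, hs, hm⟩ := Set.exists_max_image {s | I.IsResponse x s}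
    (fun s => ∑ i, I.stateGain i (s i)) (Set.toFinite _) ⟨_, h0⟩
  exact ⟨s, hs, hm⟩

namespace IsBestResponse

variable {I} {x : Fin n → ℝ} {s : Fin n → Fin 3}

/-- Optimality against an exchange of states. -/
theorem exchange_le (h : I.IsBestResponse x s) (M : List (Fin n × Fin 3))
    (hM : (M.map Prod.fst).Nodup) (hx : ∀ m ∈ M, m.2 = 1 → x m.1 = 1)
    (hc : ∀ ℓ, (M.map fun m => I.stateCount ℓ m.1 m.2 - I.stateCount ℓ m.1 (s m.1)).sum = 0)
    (hd : ∑ i, stateDev i (s i) + (M.map fun m => stateDev m.1 m.2 - stateDev m.1 (s m.1)).sum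
      ≤ I.effBudget) :
    (M.map fun m => I.stateGain m.1 m.2 - I.stateGain m.1 (s m.1)).sum ≤ 0 := by
  have := h.best (exchange s M) ⟨fun ℓ => ?_, fun i hi => ?_, ?_⟩
  · rw [sum_exchange _ _ hM] at this
    linarith
  · rw [sum_exchange _ _ hM, hc, h.count, add_zero]
  · rcases exchange_eq_or_mem s M i with h' | h'
    · exact h.selected i (h' ▸ hi)
    · exact hx _ h' hi
  · rwa [sum_exchange _ _ hM]

variable {i j k l : Fin n}

/-- The two items trade states, which preserves all counts; `x i = 1` is needed because only items
of `x` may deviate. -/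
theorem base_add_dev_le (h : I.IsBestResponse x s) (hi : s i = 0) (hj : s j = 1)
    (hx : x i = 1) (hij : I.part i = I.part j) :
    I.base i + I.dev i ≤ I.base j + I.dev j := by
  have hne : i ≠ j := by rintro rfl; simp [hi] at hj
  have := h.exchange_le [(i, 1), (j, 0)] (by simp [hne]) (by simp [hx])
    (by simp [stateCount, hi, hj, hij]) (by simpa [stateDev, hi, hj] using h.dev_le)
  simp [stateGain, hi, hj] at this
  linarith

theorem base_le (h : I.IsBestResponse x s) (hi : s i = 0) (hj : s j = 2)
    (hij : I.part i = I.part j) : I.base i ≤ I.base j := by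
  have hne : i ≠ j := by rintro rfl; simp [hi] at hj
  have := h.exchange_le [(i, 2), (j, 0)] (by simp [hne]) (by simp)
    (by simp [stateCount, hi, hj, hij]) (by simpa [stateDev, hi, hj] using h.dev_le)
  simp [stateGain, hi, hj] at this
  linarith

variable (I x s) in
/-- The gains of the ways of using one more unit of the budget. -/
def augmentGains : Set ℝ :=
  {q | q = 0 ∨ (∃ k, s k = 2 ∧ x k = 1 ∧ q = I.dev k) ∨
    ∃ l k, s l = 0 ∧ s k = 2 ∧ x l = 1 ∧ I.part l = I.part k ∧ q = I.dev l + I.base l - I.base k}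

/-- Cancelling the deviation of `i` frees a unit of budget, and spending it on the augmentation
cannot be an improvement. -/
theorem augment_le_dev (h : I.IsBestResponse x s) {q : ℝ} (hq : q ∈ augmentGains I x s)
    (hi : s i = 1) : q ≤ I.dev i := by
  rcases hq with rfl | ⟨k, hk, hx, rfl⟩ | ⟨l, k, hl, hk, hx, hlk, rfl⟩
  · exact I.dev_nonneg i
  · have hne : i ≠ k := by rintro rfl; simp [hi] at hk
    have := h.exchange_le [(i, 2), (k, 1)] (by simp [hne]) (by simp [hx])
      (by simp [stateCount, hi, hk]) (by simpa [stateDev, hi, hk] using h.dev_le)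
    simp [stateGain, hi, hk] at this
    linarith
  · have h1 : i ≠ k := by rintro rfl; simp [hi] at hk
    have h2 : i ≠ l := by rintro rfl; simp [hi] at hl
    have h3 : k ≠ l := by rintro rfl; simp [hk] at hl
    have := h.exchange_le [(i, 2), (k, 0), (l, 1)] (by simp [h1, h2, h3]) (by simp [hx])
      (by simp [stateCount, hi, hk, hl, hlk]) (by simpa [stateDev, hi, hk, hl] using h.dev_le)
    simp [stateGain, hi, hk, hl] at this
    linarith

/-- Here the unit of budget is freed differently: `j` stops deviating and replaces `i` in the
adversary's solution. The augmentation then spends it. -/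
theorem augment_le (h : I.IsBestResponse x s) {q : ℝ} (hq : q ∈ augmentGains I x s)
    (hi : s i = 0) (hj : s j = 1) (hij : I.part i = I.part j) :
    q ≤ I.base j + I.dev j - I.base i := by
  have h1 : i ≠ j := by rintro rfl; simp [hi] at hj
  have hdev := h.dev_le
  rcases hq with rfl | ⟨k, hk, hx, rfl⟩ | ⟨l, k, hl, hk, hx, hlk, rfl⟩
  · have := h.exchange_le [(i, 2), (j, 0)] (by simp [h1]) (by simp)
      (by simp [stateCount, hi, hj, hij])
      (hdev.trans' (by simp [stateDev, hi, hj]))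
    simp [stateGain, hi, hj] at this
    linarith
  · have h2 : i ≠ k := by rintro rfl; simp [hi] at hk
    have h3 : j ≠ k := by rintro rfl; simp [hj] at hk
    have := h.exchange_le [(i, 2), (j, 0), (k, 1)] (by simp [h1, h2, h3]) (by simp [hx])
      (by simp [stateCount, hi, hj, hk, hij]) (by simpa [stateDev, hi, hj, hk] using h.dev_le)
    simp [stateGain, hi, hj, hk] at this
    linarith
  -- If the augmentation removes the same item `i`, the combined exchange would list `i` twice; two
  -- simple exchanges give the bound instead.
  · by_cases hil : i = l
    · subst hil
      have := h.base_add_dev_le hi hj hx hij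
      have := h.base_le hi hk hlk
      linarith
    · have h2 : i ≠ k := by rintro rfl; simp [hi] at hk
      have h3 : j ≠ k := by rintro rfl; simp [hj] at hk
      have h4 : j ≠ l := by rintro rfl; simp [hj] at hl
      have h5 : k ≠ l := by rintro rfl; simp [hk] at hl
      have := h.exchange_le [(i, 2), (j, 0), (k, 0), (l, 1)] (by simp [h1, h2, h3, h4, h5, hil])
        (by simp [hx]) (by simp [stateCount, hi, hj, hk, hl, hij, hlk])
        (by simpa [stateDev, hi, hj, hk, hl] using h.dev_le)
      simp [stateGain, hi, hj, hk, hl] at this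
      linarith

/-- With budget left over, the augmentation is feasible by itself. This is the source of
complementary slackness for `q`. -/
theorem augment_nonpos (h : I.IsBestResponse x s) {q : ℝ} (hq : q ∈ augmentGains I x s)
    (hb : ∑ i, stateDev i (s i) + 1 ≤ I.effBudget) : q ≤ 0 := by
  rcases hq with rfl | ⟨k, hk, hx, rfl⟩ | ⟨l, k, hl, hk, hx, hlk, rfl⟩
  · rfl
  · have := h.exchange_le [(k, 1)] (by simp) (by simp [hx])
      (by simp [stateCount, hk])
      (by simp [stateDev, hk] at hb ⊢; linarith)
    simp [stateGain, hk] at this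
    linarith
  · have h3 : k ≠ l := by rintro rfl; simp [hk] at hl
    have := h.exchange_le [(k, 0), (l, 1)] (by simp [h3]) (by simp [hx])
      (by simp [stateCount, hk, hl, hlk])
      (by simp [stateDev, hk, hl] at hb ⊢; linarith)
    simp [stateGain, hk, hl] at this
    linarith

end IsBestResponse

/-! ### Candidate prices and strong duality -/

/-- Take the heaviest element of `A`, or the lightest element overall if `A` is empty. That the
threshold is the weight of an actual element is what makes the candidate prices of a set finite in
number. -/
theorem exists_threshold {α : Type*} (A P : α → Prop) (w : α → ℝ) (hfin : {i | P i}.Finite)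
    (hP : ∃ i, P i) (hw : ∀ i j, P i → P j → A i → ¬ A j → w i ≤ w j) :
    ∃ i, P i ∧ ∀ j, P j → (A j → w j ≤ w i) ∧ (¬ A j → w i ≤ w j) := by
  by_cases hA : ∃ i, P i ∧ A i
  · obtain ⟨i, ⟨hi, hi'⟩, hm⟩ := Set.exists_max_image {i | P i ∧ A i} w (hfin.subset fun _ h => h.1) hA
    exact ⟨i, hi, fun j hj => ⟨fun h => hm j ⟨hj, h⟩, fun h => hw i j hi hj hi' h⟩⟩
  · push Not at hA
    obtain ⟨i, hi, hm⟩ := Set.exists_min_image {i | P i} w hfin hP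
    exact ⟨i, hi, fun j hj => ⟨fun h => absurd h (hA j hj), fun _ => hm j hj⟩⟩

/-- The values of the dual variable of the budget that have to be tried. -/
def budgetPrices : Set ℝ := {q | q = 0 ∨ ∃ i j, q = max 0 (I.dev i + I.base i - I.base j)}

/-- The values of the dual variable of the set `ℓ` that have to be tried. -/
def partPrices (q : ℝ) (ℓ : Fin I.L) : Set ℝ :=
  {a | ∃ i, I.part i = ℓ ∧ (a = I.base i ∨ a = I.base i + max 0 (I.dev i - q))}

/-- Strong duality. -/
theorem exists_dualValue_eq {x : Fin n → ℝ} (hx : x ∈ I.feasible) :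
    ∃ q ∈ I.budgetPrices, 0 ≤ q ∧ ∃ a : Fin I.L → ℝ, (∀ ℓ, a ℓ ∈ I.partPrices q ℓ) ∧
      ∃ y ∈ I.feasible, ∃ δ ∈ I.deviations,
        ∑ i, (I.base i + I.dev i * δ i) * x i - ∑ i, (I.base i + I.dev i * δ i) * y i
          = I.dualValue q a x := by
  obtain ⟨s, h⟩ := I.exists_isBestResponse hx
  have hfin : (IsBestResponse.augmentGains I x s).Finite := by
    refine Set.Finite.subset (((Set.finite_singleton 0).union (Set.finite_range I.dev)).union
      (Set.finite_range fun m : Fin n × Fin n => I.dev m.1 + I.base m.1 - I.base m.2)) ?_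
    rintro q (rfl | ⟨k, -, -, rfl⟩ | ⟨l, k, -, -, -, -, rfl⟩)
    · simp
    · simp
    · exact .inr ⟨(l, k), rfl⟩
  -- The budget price is the marginal value of one more unit of budget.
  obtain ⟨q, hq, hmax⟩ := Set.exists_max_image _ id hfin ⟨0, .inl rfl⟩
  have hq0 : 0 ≤ q := hmax 0 (.inl rfl)
  have hA : ∀ k, s k = 2 → x k = 1 → I.dev k ≤ q := fun k hk hxk =>
    hmax _ (.inr (.inl ⟨k, hk, hxk, rfl⟩))
  have hB : ∀ l k, s l = 0 → s k = 2 → x l = 1 → I.part l = I.part k →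
      I.dev l + I.base l - I.base k ≤ q := fun l k hl hk hxl hlk =>
    hmax _ (.inr (.inr ⟨l, k, hl, hk, hxl, hlk, rfl⟩))
  have hD : ∀ i, s i = 1 → q ≤ I.dev i := fun i hi => h.augment_le_dev hq hi
  have hcand : q ∈ I.budgetPrices := by
    rcases id hq with hq | ⟨k, -, -, hq⟩ | ⟨l, k, -, -, -, -, hq⟩
    · exact .inl hq
    · exact .inr ⟨k, k, by rw [max_eq_right] <;> linarith⟩
    · exact .inr ⟨l, k, by rw [max_eq_right] <;> linarith⟩
  have hstate : ∀ i, s i = 0 ∨ s i = 1 ∨ s i = 2 := fun i => by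
    generalize s i = t; fin_cases t <;> simp
  -- Effective cost to the adversary of taking item `i` into his solution: its base cost, plus, if
  -- `x` contains it, the forgone profit of a deviation net of the price `q`.
  set w : Fin n → ℝ := fun i => I.base i + x i * max 0 (I.dev i - q) with hw
  have hw0 : ∀ i, x i = 0 → w i = I.base i := fun i hi => by simp [hw, hi]
  have hw1 : ∀ i, x i = 1 → w i = I.base i + max 0 (I.dev i - q) := fun i hi => by simp [hw, hi]
  have hwD : ∀ i, s i = 1 → w i = I.base i + I.dev i - q := fun i hi => by
    rw [hw1 i (h.selected i hi), max_eq_right (by linarith [hD i hi])]; ring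
  have hwN : ∀ i, s i = 2 → w i = I.base i := fun i hi => by
    rcases hx.1 i with h' | h'
    · exact hw0 i h'
    · rw [hw1 i h', max_eq_left (by linarith [hA i hi h']), add_zero]
  -- Within a set, the items that the adversary takes are those of least effective cost; the price
  -- of the set is the separating threshold.
  have hth : ∀ ℓ, ∃ i, I.part i = ℓ ∧ ∀ j, I.part j = ℓ →
      (s j = 0 → w j ≤ w i) ∧ (s j ≠ 0 → w i ≤ w j) := by
    refine fun ℓ => exists_threshold (fun i => s i = 0) (fun i => I.part i = ℓ) w
      (Set.toFinite _) (I.part_surjective ℓ) ?_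
    rintro i j rfl hj hi hsj
    have hij := hj.symm
    rcases hstate j with hj0 | hj1 | hj2
    · exact absurd hj0 hsj
    · rw [hwD j hj1]
      have h1 := h.augment_le hq hi hj1 hij
      rcases hx.1 i with h' | h'
      · rw [hw0 i h']; linarith
      · have h2 := h.base_add_dev_le hi hj1 h' hij
        rw [hw1 i h']
        rcases max_cases 0 (I.dev i - q) with h3 | h3 <;> linarith
    · rw [hwN j hj2]
      have h1 := h.base_le hi hj2 hij
      rcases hx.1 i with h' | h'
      · rwa [hw0 i h']
      · have h2 := hB i j hi hj2 h' hij
        rw [hw1 i h']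
        rcases max_cases 0 (I.dev i - q) with h3 | h3 <;> linarith
  choose f hf hth using hth
  refine ⟨q, hcand, hq0, fun ℓ => w (f ℓ), fun ℓ => ⟨f ℓ, hf ℓ, ?_⟩,
    fun i => if s i = 0 then 1 else 0, ⟨fun i => ?_, fun ℓ => ?_⟩,
    fun i => if s i = 1 then 1 else 0, ⟨fun i => ?_, ?_⟩, ?_⟩
  · rcases hx.1 (f ℓ) with h' | h'
    · exact .inl (hw0 _ h')
    · exact .inr (hw1 _ h')
  · by_cases hi : s i = 0 <;> simp [hi]
  · rw [← h.count ℓ, T, Finset.sum_filter]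
    refine Finset.sum_congr rfl fun i _ => ?_
    by_cases h1 : s i = 0 <;> by_cases h2 : I.part i = ℓ <;> simp [stateCount, h1, h2]
  · by_cases hi : s i = 1 <;> simp [hi]
  · exact h.dev_le.trans (by rw [effBudget, Nat.cast_min]; exact min_le_left _ _)
  · have hyT : ∀ ℓ, ∑ i ∈ I.T ℓ, (if s i = 0 then (1 : ℝ) else 0) = I.p ℓ := by
      intro ℓ
      rw [← h.count ℓ, T, Finset.sum_filter]
      refine Finset.sum_congr rfl fun i _ => ?_
      by_cases h1 : s i = 0 <;> by_cases h2 : I.part i = ℓ <;> simp [stateCount, h1, h2]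
    -- Complementary slackness for each item: its state determines which argument attains the
    -- maximum in the dual objective.
    have item : ∀ i, I.base i * x i + max (max 0 (w (f (I.part i)) - I.base i))
          (x i * (I.dev i - q)) =
        ((I.base i + I.dev i * (if s i = 1 then 1 else 0)) * x i
          - (I.base i + I.dev i * (if s i = 1 then 1 else 0)) * (if s i = 0 then 1 else 0))
          + w (f (I.part i)) * (if s i = 0 then 1 else 0) - q * stateDev i (s i) := by
      intro i
      have h1 := hth (I.part i) i rfl
      rcases hstate i with hi | hi | hi
      · have h2 := h1.1 hi
        simp only [hi, stateDev]
        rcases hx.1 i with h' | h'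
        · rw [hw0 i h'] at h2
          simp only [h']
          rw [max_eq_left (by simp), max_eq_right (by linarith)]
          simp; ring
        · rw [hw1 i h'] at h2
          simp only [h']
          have h3 := le_max_left 0 (I.dev i - q)
          have h4 := le_max_right 0 (I.dev i - q)
          rw [max_eq_right (a := 0) (by linarith), max_eq_left (by linarith)]
          simp
      · have h2 := h1.2 (by simp [hi])
        have h3 := hD i hi
        rw [hwD i hi] at h2
        have h4 : max 0 (w (f (I.part i)) - I.base i) ≤ 1 * (I.dev i - q) :=
          max_le (by linarith) (by linarith)
        rw [h.selected i hi, max_eq_right h4]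
        simp [hi, stateDev]; ring
      · have h2 := h1.2 (by simp [hi])
        rw [hwN i hi] at h2
        have h4 : x i * (I.dev i - q) ≤ 0 := by
          rcases hx.1 i with h' | h'
          · simp [h']
          · rw [h']; linarith [hA i hi h']
        rw [max_eq_left (a := 0) (by linarith), max_eq_left h4]
        simp [hi, stateDev]
    -- Either a full unit of budget is left, and then `q = 0`, or the budget is exhausted, since the
    -- number of deviations is an integer.
    have slack : q * (I.effBudget - ∑ i, stateDev i (s i)) = 0 := by
      by_cases hs : ∑ i, stateDev i (s i) + 1 ≤ I.effBudget
      · rw [le_antisymm (h.augment_nonpos hq hs) hq0, zero_mul]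
      · have h1 : ∑ i, stateDev i (s i) = ((∑ i, if s i = 1 then 1 else 0 : ℕ) : ℝ) := by
          push_cast; rfl
        have h2 := h.dev_le
        rw [h1] at hs h2 ⊢
        norm_cast at hs h2
        rw [show I.effBudget = _ from le_antisymm (by omega) h2]
        simp
    rw [dualValue, Finset.sum_congr rfl fun i _ => item i, Finset.sum_sub_distrib,
      Finset.sum_add_distrib, Finset.sum_sub_distrib,
      I.sum_part_mul (fun ℓ => w (f ℓ)) fun i => if s i = 0 then 1 else 0, ← Finset.mul_sum]
    simp only [hyT]
    linarith

/-! ### Reduction to minimizing the dual value -/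

theorem feasible_finite : I.feasible.Finite := by
  refine Set.Finite.subset (Set.Finite.pi' fun _ : Fin n => Set.toFinite {(0 : ℝ), 1}) ?_
  intro x hx i
  simpa using hx.1 i

theorem exists_isNominalValue (h : I.feasible.Nonempty) (c : Fin n → ℝ) :
    ∃ m, I.IsNominalValue c m := by
  obtain ⟨y, hy, hm⟩ := Set.exists_min_image _ (fun y => ∑ i, c i * y i) I.feasible_finite h
  exact ⟨_, ⟨y, hy, rfl⟩, by rintro _ ⟨z, hz, rfl⟩; exact hm z hz⟩

theorem exists_isMaxRegret {x : Fin n → ℝ} (hx : x ∈ I.feasible) :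
    ∃ q ∈ I.budgetPrices, 0 ≤ q ∧ ∃ a : Fin I.L → ℝ, (∀ ℓ, a ℓ ∈ I.partPrices q ℓ) ∧
      I.IsMaxRegret x (I.dualValue q a x) := by
  obtain ⟨q, hq, hq0, a, ha, y, hy, δ, hδ, he⟩ := I.exists_dualValue_eq hx
  have hle : ∀ w ∈ {w | ∃ c ∈ I.scenarios, ∃ m, I.IsNominalValue c m ∧ w = ∑ i, c i * x i - m},
      w ≤ I.dualValue q a x := by
    rintro w ⟨c, ⟨δ', hδ', hc⟩, m, ⟨⟨y', hy', rfl⟩, -⟩, rfl⟩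
    simp only [hc]
    exact I.regret_le_dualValue hq0 a hx hy' hδ'
  refine ⟨q, hq, hq0, a, ha, ?_, hle⟩
  -- Under the scenario `δ` from strong duality the regret is at least the dual value, because the
  -- nominal optimum `m` is at most the cost of `y`; weak duality gives the converse.
  obtain ⟨m, hm⟩ := I.exists_isNominalValue ⟨x, hx⟩ fun i => I.base i + I.dev i * δ i
  have hmem : ∑ i, (I.base i + I.dev i * δ i) * x i - m ∈
      {w | ∃ c ∈ I.scenarios, ∃ m, I.IsNominalValue c m ∧ w = ∑ i, c i * x i - m} :=
    ⟨_, ⟨δ, hδ, fun _ => rfl⟩, m, hm, rfl⟩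
  have h1 := hle _ hmem
  have h2 := hm.2 ⟨y, hy, rfl⟩
  rwa [le_antisymm h1 (by simp only at h2; linarith)] at hmem

theorem IsMaxRegret.le_dualValue {x : Fin n → ℝ} {r : ℝ} (h : I.IsMaxRegret x r)
    (hx : x ∈ I.feasible) {q : ℝ} (hq : 0 ≤ q) (a : Fin I.L → ℝ) : r ≤ I.dualValue q a x := by
  obtain ⟨⟨c, ⟨δ, hδ, hc⟩, m, ⟨⟨y, hy, rfl⟩, -⟩, rfl⟩, -⟩ := h
  simp only [hc]
  exact I.regret_le_dualValue hq a hx hy hδ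

/-- A minimizer of the dual value solves the min-max regret problem. -/
theorem isMinMaxRegret_of_forall_dualValue_le {x : Fin n → ℝ} {q : ℝ} {a : Fin I.L → ℝ}
    (hx : x ∈ I.feasible) (hq : 0 ≤ q)
    (h : ∀ q' ∈ I.budgetPrices, ∀ a' : Fin I.L → ℝ, (∀ ℓ, a' ℓ ∈ I.partPrices q' ℓ) →
      ∀ z ∈ I.feasible, I.dualValue q a x ≤ I.dualValue q' a' z) :
    I.IsMinMaxRegret x (I.dualValue q a x) := by
  -- The prices `q`, `a` need not be candidates: the maximum regret of `x` is attained by candidates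
  -- `q₁`, `a₁` and squeezed between the two dual values.
  obtain ⟨q₁, hq₁, -, a₁, ha₁, hr⟩ := I.exists_isMaxRegret hx
  rw [← le_antisymm (h q₁ hq₁ a₁ ha₁ x hx) (IsMaxRegret.le_dualValue I hr hx hq a)] at hr
  refine ⟨hx, hr, ⟨x, hx, hr⟩, ?_⟩
  rintro r ⟨z, hz, hrz⟩
  obtain ⟨q₂, hq₂, -, a₂, ha₂, hr₂⟩ := I.exists_isMaxRegret hz
  rw [hrz.unique hr₂]
  exact h q₂ hq₂ a₂ ha₂ z hz

end SelectionInstance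

/-! ### Total correctness with step bounds -/

namespace RAM

/-- Started on `s`, the program `c` halts after at most `T` steps on a memory satisfying `Q`. -/
def Runs (c : Program) (s : Store) (T : ℕ) (Q : Store → Prop) : Prop :=
  ∃ s' t, Exec c s s' t ∧ t ≤ T ∧ Q s'

/-- Does the program contain an assignment to the array `a` of natural numbers? -/
def Program.writesNat (a : ℕ) : Program → Bool
  | .skip => false
  | .setNat b _ _ => b == a
  | .setReal _ _ _ => false
  | .seq c c' => c.writesNat a || c'.writesNat a
  | .branch _ c c' => c.writesNat a || c'.writesNat a
  | .loop _ c => c.writesNat a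

/-- Does the program contain an assignment to the array `a` of real numbers? -/
def Program.writesReal (a : ℕ) : Program → Bool
  | .skip => false
  | .setNat _ _ _ => false
  | .setReal b _ _ => b == a
  | .seq c c' => c.writesReal a || c'.writesReal a
  | .branch _ c c' => c.writesReal a || c'.writesReal a
  | .loop _ c => c.writesReal a

/-- The memories `s` and `s'` agree on all arrays that `c` does not assign to. -/
structure Frame (c : Program) (s s' : Store) : Prop where
  nat : ∀ a, c.writesNat a = false → s'.nat a = s.nat a
  real : ∀ a, c.writesReal a = false → s'.real a = s.real a

/-- Whether an array survives a program is thereby reduced to a computation on the program text,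
which `rfl` settles at each use. -/
theorem Exec.frame {c : Program} {s s' : Store} {t : ℕ} (h : Exec c s s' t) : Frame c s s' := by
  induction h with
  | skip s => exact ⟨fun _ _ => rfl, fun _ _ => rfl⟩
  | setNat s a i e =>
    refine ⟨fun b hb => ?_, fun _ _ => rfl⟩
    have : b ≠ a := by rintro rfl; simp [Program.writesNat] at hb
    simp [Store.writeNat, this]
  | setReal s a i e =>
    refine ⟨fun _ _ => rfl, fun b hb => ?_⟩
    have : b ≠ a := by rintro rfl; simp [Program.writesReal] at hb
    simp [Store.writeReal, this]
  | seq _ _ ih ih' =>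
    constructor <;> intro a ha <;>
      simp only [Program.writesNat, Program.writesReal, Bool.or_eq_false_iff] at ha
    · rw [ih'.nat a ha.2, ih.nat a ha.1]
    · rw [ih'.real a ha.2, ih.real a ha.1]
  | branch_true _ _ ih =>
    constructor <;> intro a ha <;>
      simp only [Program.writesNat, Program.writesReal, Bool.or_eq_false_iff] at ha
    · exact ih.nat a ha.1
    · exact ih.real a ha.1
  | branch_false _ _ ih =>
    constructor <;> intro a ha <;>
      simp only [Program.writesNat, Program.writesReal, Bool.or_eq_false_iff] at ha
    · exact ih.nat a ha.2
    · exact ih.real a ha.2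
  | loop_true _ _ _ ih ih' =>
    constructor <;> intro a ha
    · rw [ih'.nat a ha, ih.nat a ha]
    · rw [ih'.real a ha, ih.real a ha]
  | loop_false _ => exact ⟨fun _ _ => rfl, fun _ _ => rfl⟩

namespace Runs

variable {c c' : Program} {s : Store} {T T' : ℕ} {Q Q' : Store → Prop}

theorem mono (h : Runs c s T Q) (hT : T ≤ T') (hQ : ∀ s', Q s' → Frame c s s' → Q' s') :
    Runs c s T' Q' := by
  obtain ⟨s', t, h, ht, hq⟩ := h
  exact ⟨s', t, h, ht.trans hT, hQ s' hq h.frame⟩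

theorem seq (h : Runs c s T Q') (h' : ∀ s', Q' s' → Frame c s s' → Runs c' s' T' Q) :
    Runs (.seq c c') s (T + T') Q := by
  obtain ⟨s', t, h, ht, hq⟩ := h
  obtain ⟨s'', t', k, ht', hq'⟩ := h' s' hq h.frame
  exact ⟨s'', t + t', h.seq k, by omega, hq'⟩

theorem branch {b : Test} (h : b.Holds s → Runs c s T Q) (h' : ¬ b.Holds s → Runs c' s T Q) :
    Runs (.branch b c c') s (b.cost + T) Q := by
  by_cases hb : b.Holds s
  · obtain ⟨s', t, h, ht, hq⟩ := h hb
    exact ⟨s', _, .branch_true hb h, by omega, hq⟩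
  · obtain ⟨s', t, h, ht, hq⟩ := h' hb
    exact ⟨s', _, .branch_false hb h, by omega, hq⟩

end Runs

/-- For programs without loops: the weakest condition before the program that ensures `Q` after
it. -/
def Program.wp : Program → (Store → Prop) → Store → Prop
  | .skip, Q, s => Q s
  | .setNat a i e, Q, s => Q (s.writeNat a (i.eval s) (e.eval s))
  | .setReal a i e, Q, s => Q (s.writeReal a (i.eval s) (e.eval s))
  | .seq c c', Q, s => c.wp (c'.wp Q) s
  | .branch b c c', Q, s => (b.Holds s → c.wp Q s) ∧ (¬ b.Holds s → c'.wp Q s)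
  | .loop _ _, _, _ => False

/-- Upper bound for the number of steps of a program without loops. -/
def Program.steps : Program → ℕ
  | .skip => 1
  | .setNat _ i e => i.cost + e.cost + 1
  | .setReal _ i e => i.cost + e.cost + 1
  | .seq c c' => c.steps + c'.steps
  | .branch b c c' => b.cost + max c.steps c'.steps
  | .loop _ _ => 0

/-- The value `0` of `steps` on loops is harmless, because `wp` is `False` there. -/
theorem Runs.of_wp {c : Program} {s : Store} {T : ℕ} {Q : Store → Prop} (h : c.wp Q s)
    (hT : c.steps ≤ T) : Runs c s T Q := by
  refine Runs.mono (T := c.steps) ?_ hT fun _ h _ => h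
  clear hT
  induction c generalizing s Q with
  | skip => exact ⟨_, _, .skip s, le_rfl, h⟩
  | setNat a i e => exact ⟨_, _, .setNat s a i e, le_rfl, h⟩
  | setReal a i e => exact ⟨_, _, .setReal s a i e, le_rfl, h⟩
  | seq c c' ih ih' => exact (ih h).seq fun s' hs' _ => ih' hs'
  | branch b c c' ih ih' =>
    exact Runs.branch
      (fun hb => (ih (h.1 hb)).mono (le_max_left _ _) fun _ h _ => h)
      (fun hb => (ih' (h.2 hb)).mono (le_max_right _ _) fun _ h _ => h)
  | loop b c => exact h.elim

theorem Runs.seq_of_wp {c c' : Program} {s : Store} {T : ℕ} {Q : Store → Prop}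
    (h : c.wp (fun s' => Frame c s s' → Runs c' s' T Q) s) :
    Runs (.seq c c') s (c.steps + T) Q :=
  (Runs.of_wp h le_rfl).seq fun _ hs' hf => hs' hf

theorem writeNat_nat (s : Store) (a i v b j : ℕ) :
    (s.writeNat a i v).nat b j = if b = a then if j = i then v else s.nat b j else s.nat b j := by
  simp only [Store.writeNat, Function.update_apply]
  by_cases h : b = a
  · subst h; simp [Function.update_apply]
  · simp [h]

theorem writeNat_real (s : Store) (a i v : ℕ) : (s.writeNat a i v).real = s.real := rfl

theorem writeReal_nat (s : Store) (a i : ℕ) (v : ℝ) : (s.writeReal a i v).nat = s.nat := rfl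

theorem writeReal_real (s : Store) (a i b j : ℕ) (v : ℝ) :
    (s.writeReal a i v).real b j =
      if b = a then if j = i then v else s.real b j else s.real b j := by
  simp only [Store.writeReal, Function.update_apply]
  by_cases h : b = a
  · subst h; simp [Function.update_apply]
  · simp [h]

/-- The scalar variable held in the first cell of the array `a` of natural numbers. -/
def natVar (a : ℕ) : NatExpr := .load a (.const 0)

/-- The scalar variable held in the first cell of the array `a` of real numbers. -/
def realVar (a : ℕ) : RealExpr := .load a (.const 0)

/-- "For `v` from `0` to `e - 1` do `c`". -/
def forLoop (v : ℕ) (e : NatExpr) (c : Program) : Program :=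
  .seq (.setNat v (.const 0) (.const 0))
    (.loop (.natLe (.add (natVar v) (.const 1)) e)
      (.seq c (.setNat v (.const 0) (.add (natVar v) (.const 1)))))

/-- Rule for `forLoop`: the body keeps the counter and the bound, and takes `Inv k` to
`Inv (k + 1)`. -/
theorem Runs.forLoop {v : ℕ} {e : NatExpr} {c : Program} {s : Store} {N T : ℕ}
    (Inv : ℕ → Store → Prop) (hv : c.writesNat v = false)
    (he : ∀ s', Frame (RAM.forLoop v e c) s s' → e.eval s' = N)
    (h0 : Inv 0 (s.writeNat v 0 0))
    (hstep : ∀ k < N, ∀ s', Inv k s' → s'.nat v 0 = k → Frame (RAM.forLoop v e c) s s' →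
      Runs c s' T fun s'' => Inv (k + 1) (s''.writeNat v 0 (k + 1))) :
    Runs (RAM.forLoop v e c) s (N * (T + e.cost + 11) + e.cost + 8) (Inv N) := by
  -- Induction on the number `j` of remaining iterations. An iteration costs `e.cost + 5` for the
  -- test, at most `T` for the body and `6` for the increment; the last test costs `e.cost + 5`, and
  -- setting the counter to zero `3`.
  have key : ∀ j k s', j + k = N → Inv k s' → s'.nat v 0 = k → Frame (RAM.forLoop v e c) s s' →
      Runs (.loop (.natLe (.add (natVar v) (.const 1)) e)
        (.seq c (.setNat v (.const 0) (.add (natVar v) (.const 1))))) s'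
        (j * (T + e.cost + 11) + e.cost + 5) (Inv N) := by
    intro j
    induction j with
    | zero =>
      intro k s' hk hI hs hf
      refine ⟨s', _, .loop_false ?_, ?_, ?_⟩
      · simp only [Test.Holds, NatExpr.eval, natVar, hs, he s' hf]; omega
      · simp only [Test.cost, NatExpr.cost, natVar]; omega
      · rw [zero_add] at hk; exact hk ▸ hI
    | succ j ih =>
      intro k s' hk hI hs hf
      obtain ⟨s₁, t₁, h₁, ht₁, hI₁⟩ := hstep k (by omega) s' hI hs hf
      have hv₁ : s₁.nat v 0 = k := by rw [h₁.frame.nat v hv, hs]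
      have h₂ := Exec.setNat s₁ v (.const 0) (.add (natVar v) (.const 1))
      simp only [natVar, NatExpr.eval, hv₁] at h₂
      have h₃ := h₁.seq h₂
      have hf' : Frame (RAM.forLoop v e c) s (s₁.writeNat v 0 (k + 1)) := by
        have h₄ := h₃.frame
        constructor <;> intro a ha
        · rw [← hf.nat a ha, h₄.nat a]
          simp only [RAM.forLoop, Program.writesNat, Bool.or_eq_false_iff] at ha ⊢
          exact ha.2
        · rw [← hf.real a ha, h₄.real a]
          simp only [RAM.forLoop, Program.writesReal, Bool.or_eq_false_iff] at ha ⊢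
          exact ha.2
      obtain ⟨s₂, t₂, h₅, ht₂, hI₂⟩ := ih (k + 1) _ (by omega) hI₁ (by simp [Store.writeNat]) hf'
      refine ⟨s₂, _, .loop_true ?_ h₃ h₅, ?_, hI₂⟩
      · simp only [Test.Holds, NatExpr.eval, natVar, hs, he s' hf]; omega
      · simp only [Test.cost, NatExpr.cost, natVar]
        rw [Nat.succ_mul]; omega
  obtain ⟨s', t, h, ht, hI⟩ := key N 0 (s.writeNat v 0 0) (by omega) h0
    (by simp [Store.writeNat])
    (by
      constructor <;> intro a ha
      · have : a ≠ v := by rintro rfl; simp [RAM.forLoop, Program.writesNat] at ha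
        simp [Store.writeNat, this]
      · rfl)
  exact ⟨s', _, (Exec.setNat s v (.const 0) (.const 0)).seq h,
    by simp only [NatExpr.cost]; omega, hI⟩

end RAM

namespace RAM

/-! ### The program

Arrays of natural numbers: `0`, `1`, `2` input, `3` output, `4` effective budget, `5` and `6` pair of
items that defines the budget price, `7` item that defines the price of its set, `8` that set, `9`
selection round, `10` inner counter, `11` item with the least key, `12` selection for the current
price, `13` best selection so far, `14` flags of the sets that already have a selection. Arrays of
real numbers: `0`, `1` input, `2` output, `3` price of the budget, `4` price of the set, `5` value of
the current selection, `6` positive part, `7` keys, `8` values of the best selections, `9` total. -/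

/-- The number of items. -/
def sizeExpr : NatExpr := .load 0 (.const 0)

/-- An expression that vanishes if and only if `e` and `f` agree. -/
def distExpr (e f : NatExpr) : NatExpr := .add (.sub e f) (.sub f e)

/-- Unselect the current item; if it belongs to the current set, compute its key and add its share of
the constant part of the value. -/
def keysBody : Program :=
  .seq (.setNat 12 (natVar 10) (.const 0))
    (.branch (.natLe (distExpr (.load 1 (natVar 10)) (natVar 8)) (.const 0))
      (.seq (.branch (.realLe .zero (.sub (realVar 4) (.load 0 (natVar 10))))
          (.setReal 6 (.const 0) (.sub (realVar 4) (.load 0 (natVar 10))))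
          (.setReal 6 (.const 0) .zero))
      (.seq (.setReal 5 (.const 0) (.add (realVar 5) (realVar 6)))
      (.branch (.realLe (realVar 6) (.sub (.load 1 (natVar 10)) (realVar 3)))
          (.setReal 7 (natVar 10) (.sub (.add (.load 0 (natVar 10))
            (.sub (.load 1 (natVar 10)) (realVar 3))) (realVar 6)))
          (.setReal 7 (natVar 10) (.sub (.add (.load 0 (natVar 10)) (realVar 6)) (realVar 6))))))
      .skip)

/-- Compute the keys of the items of the current set, and the constant part of the value. -/
def computeKeys : Program :=
  .seq (.setReal 5 (.const 0) .zero) (forLoop 10 sizeExpr keysBody)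

/-- Compare the current item with the unselected item with the least key so far. -/
def findMinBody : Program :=
  -- A sum of natural numbers vanishes only if both summands do, so one comparison tests membership
  -- in the set and being unselected.
  .branch (.natLe (.add (distExpr (.load 1 (natVar 10)) (natVar 8)) (.load 12 (natVar 10)))
      (.const 0))
    (.branch (.natLe sizeExpr (natVar 11)) (.setNat 11 (.const 0) (natVar 10))
      (.branch (.realLe (.load 7 (natVar 11)) (.load 7 (natVar 10))) .skip
        (.setNat 11 (.const 0) (natVar 10))))
    .skip

/-- Find an unselected item of the current set with the least key. -/
def findMin : Program :=
  .seq (.setNat 11 (.const 0) sizeExpr) (forLoop 10 sizeExpr findMinBody)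

/-- Select the items with the least keys. -/
def selectMin : Program :=
  forLoop 9 (.load 2 (natVar 8))
    (.seq findMin
      (.seq (.setNat 12 (natVar 11) (.const 1))
        (.setReal 5 (.const 0) (.sub (.add (realVar 5) (.load 7 (natVar 11))) (realVar 4)))))

/-- Compute an optimal selection from the current set for the current prices. -/
def evalGroup : Program := .seq computeKeys selectMin

end RAM

/-! ### Optimal selection from one set at fixed prices -/

/-- The input of the program, as functions on the natural numbers. -/
structure RAM.Data where
  n : ℕ
  L : ℕ
  part : ℕ → ℕ
  p : ℕ → ℕ
  c : ℕ → ℝ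
  d : ℕ → ℝ

namespace RAM.Data

open RAM

variable (D : Data)

/-- The memory `s` holds the input. -/
structure In (s : Store) : Prop where
  n : s.nat 0 0 = D.n
  L : s.nat 0 1 = D.L
  part : s.nat 1 = D.part
  p : s.nat 2 = D.p
  c : s.real 0 = D.c
  d : s.real 1 = D.d

variable {D} in
theorem In.frame {s s' : Store} {P : Program} (h : D.In s) (hf : Frame P s s')
    (h0 : P.writesNat 0 = false := by rfl) (h1 : P.writesNat 1 = false := by rfl)
    (h2 : P.writesNat 2 = false := by rfl) (h3 : P.writesReal 0 = false := by rfl)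
    (h4 : P.writesReal 1 = false := by rfl) : D.In s' :=
  ⟨by rw [hf.nat 0 h0, h.n], by rw [hf.nat 0 h0, h.L], by rw [hf.nat 1 h1, h.part],
    by rw [hf.nat 2 h2, h.p], by rw [hf.real 0 h3, h.c], by rw [hf.real 1 h4, h.d]⟩

/-- The items of the set `ℓ`. -/
def group (ℓ : ℕ) : Finset ℕ := (Finset.range D.n).filter fun k => D.part k = ℓ

/-- `x` selects the right number of items of the set `ℓ`. -/
def IsSelection (ℓ : ℕ) (x : ℕ → ℕ) : Prop :=
  (∀ k ∈ D.group ℓ, x k ≤ 1) ∧ ∑ k ∈ D.group ℓ, x k = D.p ℓ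

/-- Increase of the dual value if item `k` is selected. -/
noncomputable def key (q a : ℝ) (k : ℕ) : ℝ :=
  D.c k + max (max 0 (a - D.c k)) (D.d k - q) - max 0 (a - D.c k)

/-- Contribution of the set `ℓ` to the dual value. -/
noncomputable def groupValue (q : ℝ) (ℓ : ℕ) (a : ℝ) (x : ℕ → ℕ) : ℝ :=
  ∑ k ∈ D.group ℓ, max 0 (a - D.c k) + ∑ k ∈ D.group ℓ, x k * D.key q a k - D.p ℓ * a

/-- If `θ` is a threshold separating the weights on `S` from the others, every term `(x k - 1_S k) *
(w k - θ)` is nonnegative, and `θ` drops out of the sum because the cardinalities agree. -/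
theorem sum_key_le {ι : Type*} [DecidableEq ι] {G S : Finset ι} {w : ι → ℝ} {x : ι → ℕ}
    (hS : S ⊆ G) (hw : ∀ i ∈ S, ∀ j ∈ G, j ∉ S → w i ≤ w j) (hx : ∀ k ∈ G, x k ≤ 1)
    (hc : ∑ k ∈ G, x k = S.card) : ∑ k ∈ S, w k ≤ ∑ k ∈ G, x k * w k := by
  rcases G.eq_empty_or_nonempty with rfl | hG
  · simp [Finset.subset_empty.1 hS]
  obtain ⟨i, -, hi⟩ := SelectionInstance.exists_threshold (· ∈ S) (· ∈ G) w G.finite_toSet hG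
    fun i j _ hj hi hj' => hw i hi j hj hj'
  have h1 : ∑ k ∈ S, w k = ∑ k ∈ G, (if k ∈ S then 1 else 0) * w k := by
    simp [Finset.sum_ite_mem, Finset.inter_eq_right.2 hS]
  have h2 : ∑ k ∈ G, ((x k : ℝ) - if k ∈ S then 1 else 0) = 0 := by
    rw [Finset.sum_sub_distrib, ← Nat.cast_sum, hc]
    simp [Finset.sum_ite_mem, Finset.inter_eq_right.2 hS]
  have h3 : 0 ≤ ∑ k ∈ G, ((x k : ℝ) - if k ∈ S then 1 else 0) * (w k - w i) := by
    refine Finset.sum_nonneg fun k hk => ?_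
    by_cases hkS : k ∈ S
    · have := (hi k hk).1 hkS
      have h4 : (x k : ℝ) ≤ 1 := by exact_mod_cast hx k hk
      simp only [hkS, if_true]; nlinarith
    · have := (hi k hk).2 hkS
      simp only [hkS, if_false]
      exact mul_nonneg (by simp) (by linarith)
  simp only [mul_sub, Finset.sum_sub_distrib] at h3
  rw [← Finset.sum_mul, h2] at h3
  simp only [sub_mul, Finset.sum_sub_distrib] at h3
  linarith

end RAM.Data

namespace RAM

open Data

variable {D : Data} {s : Store}

theorem distExpr_eval_le {e f : NatExpr} : (distExpr e f).eval s ≤ 0 ↔ e.eval s = f.eval s := by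
  simp only [distExpr, NatExpr.eval]; omega

theorem mem_group {D : Data} {ℓ k : ℕ} : k ∈ D.group ℓ ↔ k < D.n ∧ D.part k = ℓ := by
  simp [group]

theorem runs_computeKeys (h : D.In s) :
    Runs computeKeys s (D.n * 100 + 13) fun s' =>
      (∀ k < D.n, s'.nat 12 k = 0) ∧
      (∀ k ∈ D.group (s.nat 8 0), s'.real 7 k = D.key (s.real 3 0) (s.real 4 0) k) ∧
      s'.real 5 0 = ∑ k ∈ D.group (s.nat 8 0), max 0 (s.real 4 0 - D.c k) := by
  refine (Runs.seq_of_wp fun hf₁ => ?_).mono (T := 3 + (D.n * 100 + 10)) (by omega)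
    fun _ h _ => h
  have h₁ := h.frame hf₁
  -- `87` bounds the body; the loop adds `11` and the cost `2` of its bound, which makes `100` per
  -- item.
  refine (Runs.forLoop (N := D.n) (T := 87) (fun k s' => (∀ j < k, s'.nat 12 j = 0) ∧
    (∀ j < k, D.part j = s.nat 8 0 → s'.real 7 j = D.key (s.real 3 0) (s.real 4 0) j) ∧
      s'.real 5 0 = ∑ j ∈ Finset.range k,
        if D.part j = s.nat 8 0 then max 0 (s.real 4 0 - D.c j) else 0)
    rfl (by intro s' hf; exact (h₁.frame hf).n) ?_ ?_).mono ?_ ?_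
  · simp [writeReal_real, writeNat_real, NatExpr.eval, RealExpr.eval]
  · rintro k hk s' ⟨hi1, hi2, hi3⟩ hc hf
    have h' := h₁.frame hf
    have e8 : s'.nat 8 = s.nat 8 := by rw [hf.nat 8 rfl, hf₁.nat 8 rfl]
    have e3 : s'.real 3 = s.real 3 := by rw [hf.real 3 rfl, hf₁.real 3 rfl]
    have e4 : s'.real 4 = s.real 4 := by rw [hf.real 4 rfl, hf₁.real 4 rfl]
    refine Runs.of_wp ?_ (by decide)
    simp only [Finset.sum_range_succ, Nat.lt_succ_iff_lt_or_eq, keysBody, Program.wp, Test.Holds,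
      distExpr_eval_le, NatExpr.eval, RealExpr.eval, natVar, realVar, writeNat_nat, writeNat_real,
      writeReal_nat, writeReal_real, h'.part, h'.c, h'.d, hc, e8, e3, e4, reduceIte,
      Nat.reduceEqDiff]
    have key_eq : D.key (s.real 3 0) (s.real 4 0) k = D.c k +
        max (max 0 (s.real 4 0 - D.c k)) (D.d k - s.real 3 0) - max 0 (s.real 4 0 - D.c k) := rfl
    refine ⟨fun hb => ⟨fun h1 => ⟨fun h2 => ?_, fun h2 => ?_⟩,
      fun h1 => ⟨fun h2 => ?_, fun h2 => ?_⟩⟩, fun hb => ?_⟩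
    · rw [max_eq_right h1, max_eq_right h2] at key_eq
      rw [if_pos hb, max_eq_right h1]
      grind
    · rw [max_eq_right h1, max_eq_left (not_le.1 h2).le] at key_eq
      rw [if_pos hb, max_eq_right h1]
      grind
    · rw [max_eq_left (not_le.1 h1).le, max_eq_right h2] at key_eq
      rw [if_pos hb, max_eq_left (not_le.1 h1).le]
      grind
    · rw [max_eq_left (not_le.1 h1).le, max_eq_left (not_le.1 h2).le] at key_eq
      rw [if_pos hb, max_eq_left (not_le.1 h1).le]
      grind
    · grind
  · simp [NatExpr.cost, sizeExpr]
  · rintro s' ⟨hi1, hi2, hi3⟩ -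
    refine ⟨hi1, fun k hk => hi2 k (mem_group.1 hk).1 (mem_group.1 hk).2, ?_⟩
    rw [hi3, group, Finset.sum_filter]

/-- The index `n`, which belongs to no item, is the mark for "nothing found yet". -/
theorem runs_findMin (h : D.In s) :
    Runs findMin s (D.n * 60 + 14) fun s' =>
      (s'.nat 11 0 = D.n ∧ ∀ k ∈ D.group (s.nat 8 0), s.nat 12 k ≠ 0) ∨
      (s'.nat 11 0 ∈ D.group (s.nat 8 0) ∧ s.nat 12 (s'.nat 11 0) = 0 ∧
        ∀ k ∈ D.group (s.nat 8 0), s.nat 12 k = 0 → s.real 7 (s'.nat 11 0) ≤ s.real 7 k) := by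
  refine (Runs.seq_of_wp fun hf₁ => ?_).mono (T := 4 + (D.n * 60 + 10)) (by omega)
    fun _ h _ => h
  have h₁ := h.frame hf₁
  simp only [mem_group]
  refine (Runs.forLoop (N := D.n) (T := 47) (fun k s' =>
    (s'.nat 11 0 = D.n ∧ ∀ j < k, D.part j = s.nat 8 0 → s.nat 12 j ≠ 0) ∨
      ((s'.nat 11 0 < D.n ∧ D.part (s'.nat 11 0) = s.nat 8 0) ∧ s.nat 12 (s'.nat 11 0) = 0 ∧
        ∀ j < k, D.part j = s.nat 8 0 → s.nat 12 j = 0 → s.real 7 (s'.nat 11 0) ≤ s.real 7 j))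
    rfl (by intro s' hf; exact (h₁.frame hf).n) ?_ ?_).mono ?_ ?_
  · simp [writeNat_nat, NatExpr.eval, sizeExpr, h.n]
  · rintro k hk s' hi hc hf
    have h' := h₁.frame hf
    have e8 : s'.nat 8 = s.nat 8 := by rw [hf.nat 8 rfl, hf₁.nat 8 rfl]
    have e12 : s'.nat 12 = s.nat 12 := by rw [hf.nat 12 rfl, hf₁.nat 12 rfl]
    have e7 : s'.real 7 = s.real 7 := by rw [hf.real 7 rfl, hf₁.real 7 rfl]
    refine Runs.of_wp ?_ (by decide)
    simp only [Nat.lt_succ_iff_lt_or_eq, findMinBody, Program.wp, Test.Holds,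
      NatExpr.eval, RealExpr.eval, distExpr, natVar, sizeExpr, writeNat_nat, h'.n, h'.part, hc, e8,
      e7, e12, reduceIte, Nat.reduceEqDiff]
    generalize s'.nat 11 0 = m at *
    refine ⟨fun hb => ⟨fun h1 => ?_, fun h1 => ⟨fun h2 => ?_, fun h2 => ?_⟩⟩, fun hb => ?_⟩
    · grind
    · grind
    · grind
    · grind
  · simp [NatExpr.cost, sizeExpr]
  · rintro s' hi -
    grind

/-- In place of a multiplication, the price of the set is subtracted once per selected item. The
last conjunct is the hypothesis on `S` in `sum_key_le`. -/
theorem runs_selectMin (h : D.In s) (hp : D.p (s.nat 8 0) ≤ (D.group (s.nat 8 0)).card)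
    (h12 : ∀ k < D.n, s.nat 12 k = 0) :
    Runs selectMin s (D.p (s.nat 8 0) * (D.n * 60 + 60) + 11) fun s' =>
      ∃ S ⊆ D.group (s.nat 8 0), S.card = D.p (s.nat 8 0) ∧
        (∀ k < D.n, s'.nat 12 k = if k ∈ S then 1 else 0) ∧
        s'.real 5 0 = s.real 5 0 + ∑ k ∈ S, s.real 7 k - D.p (s.nat 8 0) * s.real 4 0 ∧
        ∀ i ∈ S, ∀ j ∈ D.group (s.nat 8 0), j ∉ S → s.real 7 i ≤ s.real 7 j := by
  refine (Runs.forLoop (N := D.p (s.nat 8 0)) (T := D.n * 60 + 14 + 20) (fun r s' =>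
    ∃ S ⊆ D.group (s.nat 8 0), S.card = r ∧
        (∀ k < D.n, s'.nat 12 k = if k ∈ S then 1 else 0) ∧
        s'.real 5 0 = s.real 5 0 + ∑ k ∈ S, s.real 7 k - r * s.real 4 0 ∧
        ∀ i ∈ S, ∀ j ∈ D.group (s.nat 8 0), j ∉ S → s.real 7 i ≤ s.real 7 j)
    rfl ?_ ?_ ?_).mono ?_ fun _ h _ => h
  · intro s' hf
    simp only [NatExpr.eval, natVar, (h.frame hf).p, hf.nat 8 rfl]
  · refine ⟨∅, by simp, by simp, ?_, ?_, by simp⟩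
    · simpa [writeNat_nat] using h12
    · simp [writeNat_real]
  · rintro r hr s₁ ⟨S, hSG, hSr, hsel, hg, hmin⟩ hc hf
    have h₁ := h.frame hf
    have e8 : s₁.nat 8 = s.nat 8 := hf.nat 8 rfl
    have e4 : s₁.real 4 = s.real 4 := hf.real 4 rfl
    have e7 : s₁.real 7 = s.real 7 := hf.real 7 rfl
    refine (runs_findMin h₁).seq fun s₂ hs₂ hf₂ => Runs.of_wp ?_ (by decide)
    rw [e8, e7] at hs₂
    have hlt : ∀ k ∈ D.group (s.nat 8 0), k < D.n := fun k hk => (mem_group.1 hk).1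
    have hm : s₂.nat 11 0 ∈ D.group (s.nat 8 0) ∧ s₂.nat 11 0 ∉ S ∧
        ∀ k ∈ D.group (s.nat 8 0), k ∉ S → s.real 7 (s₂.nat 11 0) ≤ s.real 7 k := by
      -- The search cannot fail: `S` has `r < p ℓ` elements, fewer than the set.
      rcases hs₂ with ⟨-, hs₂⟩ | ⟨hs₂, hs₃, hs₄⟩
      · exfalso
        have : D.group (s.nat 8 0) ⊆ S := fun k hk => by
          by_contra hkS
          exact hs₂ k hk (by rw [hsel k (hlt k hk), if_neg hkS])
        have := Finset.card_le_card this
        omega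
      · refine ⟨hs₂, fun hmem => ?_, fun k hk hkS => hs₄ k hk ?_⟩
        · rw [hsel _ (hlt _ hs₂), if_pos hmem] at hs₃; omega
        · rw [hsel k (hlt k hk), if_neg hkS]
    have e12 : s₂.nat 12 = s₁.nat 12 := hf₂.nat 12 rfl
    have e5 : s₂.real 5 = s₁.real 5 := hf₂.real 5 rfl
    have e7' : s₂.real 7 = s.real 7 := by rw [hf₂.real 7 rfl, e7]
    have e4' : s₂.real 4 = s.real 4 := by rw [hf₂.real 4 rfl, e4]
    simp only [Program.wp, NatExpr.eval, RealExpr.eval, natVar, realVar, writeNat_nat,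
      writeNat_real, writeReal_nat, writeReal_real, e12, e5, e7', e4', reduceIte,
      Nat.reduceEqDiff]
    obtain ⟨hm1, hm2, hm3⟩ := hm
    generalize s₂.nat 11 0 = m at *
    refine ⟨insert m S, Finset.insert_subset hm1 hSG, by rw [Finset.card_insert_of_notMem hm2, hSr],
      fun k hk => ?_, ?_, ?_⟩
    · simp only [Finset.mem_insert]
      by_cases hkm : k = m
      · simp [hkm]
      · simp [hkm, hsel k hk]
    · rw [Finset.sum_insert hm2, hg]; push_cast; ring
    · intro i hi j hj hjS
      rw [Finset.mem_insert, not_or] at hjS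
      rcases Finset.mem_insert.1 hi with rfl | hi
      · exact hm3 j hj hjS.2
      · exact hmin i hi j hj hjS.2
  · simp only [NatExpr.cost, natVar]; nlinarith

/-- Since `p ℓ ≤ n`, the rounds of minimum search take `O(n²)` steps. -/
theorem runs_evalGroup (h : D.In s) (hp : D.p (s.nat 8 0) ≤ (D.group (s.nat 8 0)).card) :
    Runs evalGroup s (D.n * (D.n * 60 + 160) + 24) fun s' =>
      D.IsSelection (s.nat 8 0) (s'.nat 12) ∧
      s'.real 5 0 = D.groupValue (s.real 3 0) (s.nat 8 0) (s.real 4 0) (s'.nat 12) ∧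
      ∀ x, D.IsSelection (s.nat 8 0) x →
        s'.real 5 0 ≤ D.groupValue (s.real 3 0) (s.nat 8 0) (s.real 4 0) x := by
  have hpn : D.p (s.nat 8 0) ≤ D.n := hp.trans ((Finset.card_filter_le _ _).trans (by simp))
  refine ((runs_computeKeys h).seq (T' := D.p (s.nat 8 0) * (D.n * 60 + 60) + 11)
    fun s₁ ⟨hsel, hkey, hg⟩ hf₁ => ?_).mono (by nlinarith) fun _ h _ => h
  have e8 : s₁.nat 8 = s.nat 8 := hf₁.nat 8 rfl
  have e4 : s₁.real 4 = s.real 4 := hf₁.real 4 rfl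
  have := runs_selectMin (h.frame hf₁) (by rwa [e8]) hsel
  rw [e8, e4] at this
  refine this.mono le_rfl ?_
  rintro s₂ ⟨S, hS, hcard, hsel₂, hg₂, hmin⟩ -
  have hlt : ∀ k ∈ D.group (s.nat 8 0), k < D.n := fun k hk => (mem_group.1 hk).1
  have hsel' : ∀ k ∈ D.group (s.nat 8 0), s₂.nat 12 k = if k ∈ S then 1 else 0 :=
    fun k hk => hsel₂ k (hlt k hk)
  have hkS : ∑ k ∈ S, s₁.real 7 k = ∑ k ∈ S, D.key (s.real 3 0) (s.real 4 0) k :=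
    Finset.sum_congr rfl fun k hk => hkey k (hS hk)
  rw [hg, hkS] at hg₂
  refine ⟨⟨fun k hk => ?_, ?_⟩, ?_, fun x hx => ?_⟩
  · rw [hsel' k hk]; split_ifs <;> simp
  · rw [Finset.sum_congr rfl hsel', Finset.sum_ite_mem, Finset.inter_eq_right.2 hS]
    simpa using hcard
  · rw [hg₂, groupValue]
    congr 2
    have : ∀ k ∈ D.group (s.nat 8 0), (s₂.nat 12 k : ℝ) * D.key (s.real 3 0) (s.real 4 0) k =
        if k ∈ S then D.key (s.real 3 0) (s.real 4 0) k else 0 := fun k hk => by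
      rw [hsel' k hk]; split_ifs <;> simp
    rw [Finset.sum_congr rfl this, Finset.sum_ite_mem, Finset.inter_eq_right.2 hS]
  · rw [hg₂, groupValue]
    gcongr
    refine sum_key_le hS (fun i hi j hj hjS => ?_) hx.1 (hx.2.trans hcard.symm)
    rw [← hkey i (hS hi), ← hkey j hj]
    exact hmin i hi j hj hjS

end RAM

/-! ### Search over the prices of the sets for a fixed budget price -/

namespace RAM

open Data

/-- Copy the selection from the current set to the best selection so far. -/
def copyGroup : Program :=
  forLoop 10 sizeExpr
    (.branch (.natLe (distExpr (.load 1 (natVar 10)) (natVar 8)) (.const 0))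
      (.setNat 13 (natVar 10) (.load 12 (natVar 10))) .skip)

/-- Make the current selection the best one of its set. -/
def record : Program :=
  .seq (.seq (.setReal 8 (natVar 8) (realVar 5)) (.setNat 14 (natVar 8) (.const 1))) copyGroup

/-- Evaluate the current price of the current set, and record its selection if that is the first or
an improvement. -/
def tryPrice : Program :=
  .seq evalGroup
    (.branch (.natLe (.const 1) (.load 14 (natVar 8)))
      (.branch (.realLe (.load 8 (natVar 8)) (realVar 5)) .skip record) record)

/-- Try the two prices that the current item defines for its set. -/
def tryItem : Program :=
  .seq (.seq (.setNat 8 (.const 0) (.load 1 (natVar 7)))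
    (.setReal 4 (.const 0) (.load 0 (natVar 7))))
  (.seq tryPrice
  (.seq (.branch (.realLe .zero (.sub (.load 1 (natVar 7)) (realVar 3)))
    (.setReal 4 (.const 0) (.add (.load 0 (natVar 7)) (.sub (.load 1 (natVar 7)) (realVar 3))))
    (.setReal 4 (.const 0) (.load 0 (natVar 7))))
  tryPrice))

/-- Compute an optimal solution for the current price of the budget, and its value. -/
def solvePrice : Program :=
  .seq (forLoop 10 sizeExpr (.setNat 14 (natVar 10) (.const 0)))
  (.seq (forLoop 7 sizeExpr tryItem)
  (.seq (.setReal 9 (.const 0) .zero)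
  (.seq (forLoop 10 (natVar 4) (.setReal 9 (.const 0) (.add (realVar 9) (realVar 3))))
  (forLoop 10 (.load 0 (.const 1))
    (.setReal 9 (.const 0) (.add (realVar 9) (.load 8 (natVar 10))))))))

/-- Make the current solution the output. -/
def output : Program :=
  .seq (.setReal 2 (.const 0) (realVar 9))
    (forLoop 10 sizeExpr (.setNat 3 (natVar 10) (.load 13 (natVar 10))))

namespace Data

variable (D : Data)

/-- The prices of the set `ℓ` that the first `i` items define. -/
def prices (q : ℝ) (ℓ i : ℕ) : Set ℝ :=
  {a | ∃ k < i, D.part k = ℓ ∧ (a = D.c k ∨ a = D.c k + max 0 (D.d k - q))}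

/-- The memory holds an optimal selection from the set `ℓ` for the prices in `A`. -/
def Tried (q : ℝ) (s : Store) (ℓ : ℕ) (A : Set ℝ) : Prop :=
  (s.nat 14 ℓ = 0 ∧ A = ∅) ∨
    (s.nat 14 ℓ = 1 ∧ D.IsSelection ℓ (s.nat 13) ∧
      (∃ a, s.real 8 ℓ = D.groupValue q ℓ a (s.nat 13)) ∧
      ∀ a ∈ A, ∀ x, D.IsSelection ℓ x → s.real 8 ℓ ≤ D.groupValue q ℓ a x)

/-- The dual value. -/
noncomputable def value (γ : ℕ) (q : ℝ) (a : ℕ → ℝ) (x : ℕ → ℕ) : ℝ :=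
  γ * q + ∑ ℓ ∈ Finset.range D.L, D.groupValue q ℓ (a ℓ) x

/-- Feasibility of a solution. -/
def Feasible (x : ℕ → ℕ) : Prop := ∀ ℓ < D.L, D.IsSelection ℓ x

/-- The assumptions on an instance that the program relies on. -/
structure Valid : Prop where
  part_lt : ∀ k < D.n, D.part k < D.L
  le_size : D.L ≤ D.n
  p_le : ∀ ℓ < D.L, D.p ℓ ≤ (D.group ℓ).card
  part_surj : ∀ ℓ < D.L, ∃ k < D.n, D.part k = ℓ

variable {D}

theorem Tried.mono {q : ℝ} {s : Store} {ℓ : ℕ} {A B : Set ℝ} (h : D.Tried q s ℓ A) (hB : B ⊆ A) :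
    D.Tried q s ℓ B := by
  rcases h with ⟨h1, rfl⟩ | ⟨h1, h2, h3, h4⟩
  · exact .inl ⟨h1, Set.subset_empty_iff.1 hB⟩
  · exact .inr ⟨h1, h2, h3, fun a ha => h4 a (hB ha)⟩

theorem isSelection_congr {ℓ : ℕ} {x y : ℕ → ℕ} (h : ∀ k ∈ D.group ℓ, x k = y k) :
    D.IsSelection ℓ x ↔ D.IsSelection ℓ y := by
  rw [IsSelection, IsSelection, Finset.sum_congr rfl h]
  simp +contextual [h]

theorem groupValue_congr {q a : ℝ} {ℓ : ℕ} {x y : ℕ → ℕ} (h : ∀ k ∈ D.group ℓ, x k = y k) :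
    D.groupValue q ℓ a x = D.groupValue q ℓ a y := by
  rw [groupValue, groupValue,
    Finset.sum_congr rfl fun k hk => show (x k : ℝ) * D.key q a k = _ by rw [h k hk]]

/-- A record depends on the common array `13` only through the items of its own set. Hence the sets
can be improved independently, and their selections together form one solution. -/
theorem Tried.congr {q : ℝ} {s s' : Store} {ℓ : ℕ} {A : Set ℝ} (h : D.Tried q s ℓ A)
    (h14 : s'.nat 14 ℓ = s.nat 14 ℓ) (h8 : s'.real 8 ℓ = s.real 8 ℓ)
    (h13 : ∀ k ∈ D.group ℓ, s'.nat 13 k = s.nat 13 k) : D.Tried q s' ℓ A := by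
  simpa only [Tried, h14, h8, isSelection_congr h13, groupValue_congr h13] using h

end Data

variable {D : Data} {s : Store}

theorem runs_record (h : D.In s) :
    Runs record s (D.n * 60 + 30) fun s' =>
      (∀ k < D.n, s'.nat 13 k = if D.part k = s.nat 8 0 then s.nat 12 k else s.nat 13 k) ∧
      (∀ ℓ, s'.nat 14 ℓ = if ℓ = s.nat 8 0 then 1 else s.nat 14 ℓ) ∧
      ∀ ℓ, s'.real 8 ℓ = if ℓ = s.nat 8 0 then s.real 5 0 else s.real 8 ℓ := by
  refine (Runs.seq_of_wp fun hf₁ => ?_).mono (T := 9 + (D.n * 60 + 10)) (by omega)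
    fun _ h _ => h
  have h₁ := h.frame hf₁
  simp only [NatExpr.eval, RealExpr.eval, natVar, realVar, writeReal_nat] at hf₁ h₁ ⊢
  refine (Runs.forLoop (N := D.n) (T := 47) (fun i s' =>
    (∀ k < i, s'.nat 13 k = if D.part k = s.nat 8 0 then s.nat 12 k else s.nat 13 k) ∧
    ∀ k, i ≤ k → s'.nat 13 k = s.nat 13 k)
    rfl (by intro s' hf; exact (h₁.frame hf).n) ?_ ?_).mono ?_ ?_
  · simp [writeNat_nat, writeReal_nat]
  · rintro k hk s' ⟨hi1, hi2⟩ hc hf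
    have h' := h₁.frame hf
    have e8 : s'.nat 8 = s.nat 8 := by rw [hf.nat 8 rfl, hf₁.nat 8 rfl]
    have e12 : s'.nat 12 = s.nat 12 := by rw [hf.nat 12 rfl, hf₁.nat 12 rfl]
    refine Runs.of_wp ?_ (by decide)
    simp only [Nat.lt_succ_iff_lt_or_eq, Program.wp, Test.Holds, NatExpr.eval, distExpr_eval_le,
      natVar, writeNat_nat, h'.part, hc, e8, e12, reduceIte, Nat.reduceEqDiff]
    refine ⟨fun hb => ?_, fun hb => ?_⟩ <;> grind
  · simp [NatExpr.cost, sizeExpr]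
  · rintro s' ⟨hi1, hi2⟩ hf
    refine ⟨hi1, fun ℓ => ?_, fun ℓ => ?_⟩
    · rw [hf.nat 14 rfl]; simp [writeNat_nat, writeReal_nat]
    · rw [hf.real 8 rfl]; simp [writeNat_real, writeReal_real]

theorem runs_tryPrice (h : D.In s) (hp : D.p (s.nat 8 0) ≤ (D.group (s.nat 8 0)).card)
    {A : ℕ → Set ℝ} (hA : ∀ ℓ < D.L, D.Tried (s.real 3 0) s ℓ (A ℓ)) :
    Runs tryPrice s (D.n * (D.n * 60 + 220) + 80) fun s' => ∀ ℓ < D.L,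
      D.Tried (s.real 3 0) s' ℓ (if ℓ = s.nat 8 0 then insert (s.real 4 0) (A ℓ) else A ℓ) := by
  refine ((runs_evalGroup h hp).seq (T' := D.n * 60 + 56)
    fun s₁ ⟨hsel, hg, hopt⟩ hf₁ => ?_).mono (by nlinarith) fun _ h _ => h
  have h₁ := h.frame hf₁
  have e8 : s₁.nat 8 = s.nat 8 := hf₁.nat 8 rfl
  have r8 : s₁.real 8 = s.real 8 := hf₁.real 8 rfl
  have e13 : s₁.nat 13 = s.nat 13 := hf₁.nat 13 rfl
  have e14 : s₁.nat 14 = s.nat 14 := hf₁.nat 14 rfl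
  -- Both branches that record are covered: in a first visit the premise is void, and otherwise the
  -- new value is an improvement.
  have hrec : (s.nat 14 (s.nat 8 0) = 1 → s₁.real 5 0 ≤ s.real 8 (s.nat 8 0)) →
      Runs record s₁ (D.n * 60 + 30) fun s' => ∀ ℓ < D.L,
      D.Tried (s.real 3 0) s' ℓ (if ℓ = s.nat 8 0 then insert (s.real 4 0) (A ℓ) else A ℓ) := by
    refine fun himp => (runs_record h₁).mono le_rfl ?_
    rintro s₂ ⟨h13, h14, h8⟩ - ℓ hℓ
    rw [e8] at h13 h14 h8
    by_cases hl : ℓ = s.nat 8 0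
    · have hc : ∀ k ∈ D.group ℓ, s₂.nat 13 k = s₁.nat 12 k := fun k hk => by
        rw [mem_group] at hk
        rw [h13 k hk.1, if_pos (hk.2.trans hl)]
      rw [if_pos hl]
      refine .inr ⟨by rw [h14, if_pos hl], by rw [isSelection_congr hc, hl]; exact hsel,
        ⟨s.real 4 0, by rw [groupValue_congr hc, h8, if_pos hl, hg, hl]⟩, ?_⟩
      rw [h8, if_pos hl]
      rintro a (rfl | ha) x hx
      · rw [hl] at hx ⊢; exact hopt x hx
      · rcases hA ℓ hℓ with ⟨-, he⟩ | ⟨hfl, -, -, hle⟩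
        · rw [he] at ha; exact absurd ha (Set.notMem_empty a)
        · rw [hl] at hfl
          have := hle a ha x hx
          rw [hl] at this ⊢
          exact (himp hfl).trans this
    · rw [if_neg hl]
      refine (hA ℓ hℓ).congr (by rw [h14, if_neg hl, e14]) (by rw [h8, if_neg hl, r8])
        fun k hk => ?_
      rw [mem_group] at hk
      rw [h13 k hk.1, if_neg (by rw [hk.2]; exact hl), e13]
  refine (Runs.branch (T := D.n * 60 + 30 + 20) (fun hb => ?_) fun hb => ?_).mono
    (by simp [Test.cost, NatExpr.cost, natVar]; omega) fun _ h _ => h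
  · refine (Runs.branch (T := D.n * 60 + 30) (fun hb' => ?_) fun hb' => ?_).mono
      (by simp [Test.cost, NatExpr.cost, RealExpr.cost, natVar, realVar]; omega) fun _ h _ => h
    · refine Runs.of_wp ?_ (by simp only [Program.steps]; omega)
      simp only [Program.wp, Test.Holds, NatExpr.eval, RealExpr.eval, natVar, realVar, e8, e14,
        r8] at hb hb' ⊢
      intro ℓ hℓ
      have hT : D.Tried (s.real 3 0) s₁ ℓ (A ℓ) :=
        (hA ℓ hℓ).congr (by rw [e14]) (by rw [r8]) fun k _ => by rw [e13]
      by_cases hl : ℓ = s.nat 8 0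
      · rw [if_pos hl]
        rcases hT with ⟨hfl, -⟩ | ⟨hfl, hs, ha, hle⟩
        · rw [e14, hl] at hfl; omega
        · refine .inr ⟨hfl, hs, ha, ?_⟩
          rintro a (rfl | ha) x hx
          · rw [r8, hl]; rw [hl] at hx; exact hb'.trans (hopt x hx)
          · exact hle a ha x hx
      · rwa [if_neg hl]
    · refine hrec fun _ => ?_
      simp only [Test.Holds, NatExpr.eval, RealExpr.eval, natVar, realVar, e8, r8] at hb'
      exact (not_le.1 hb').le
  · refine (hrec fun hfl => ?_).mono (by omega) fun _ h _ => h
    simp only [Test.Holds, NatExpr.eval, natVar, e8, e14] at hb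
    omega

theorem runs_tryItem (hV : D.Valid) (h : D.In s) (hi : s.nat 7 0 < D.n)
    (hA : ∀ ℓ < D.L, D.Tried (s.real 3 0) s ℓ (D.prices (s.real 3 0) ℓ (s.nat 7 0))) :
    Runs tryItem s (D.n * (D.n * 120 + 440) + 220) fun s' => ∀ ℓ < D.L,
      D.Tried (s.real 3 0) s' ℓ (D.prices (s.real 3 0) ℓ (s.nat 7 0 + 1)) := by
  refine (Runs.seq_of_wp (T := D.n * (D.n * 120 + 440) + 200) fun hf₁ => ?_).mono ?_ fun _ h _ => h
  swap
  · simp [Program.steps, NatExpr.cost, RealExpr.cost, natVar]; omega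
  have h₁ := h.frame hf₁
  generalize hs₁ : Store.writeReal _ _ _ _ = s₁ at *
  have e8 : s₁.nat 8 0 = D.part (s.nat 7 0) := by
    rw [← hs₁]; simp [writeReal_nat, writeNat_nat, NatExpr.eval, natVar, h.part]
  have e4 : s₁.real 4 0 = D.c (s.nat 7 0) := by
    rw [← hs₁]
    simp [writeReal_real, writeNat_real, writeNat_nat, NatExpr.eval, RealExpr.eval, natVar, h.c]
  have e3 : s₁.real 3 = s.real 3 := hf₁.real 3 rfl
  have e7 : s₁.nat 7 = s.nat 7 := hf₁.nat 7 rfl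
  have hpl := hV.p_le _ (hV.part_lt _ hi)
  have hA₁ : ∀ ℓ < D.L, D.Tried (s₁.real 3 0) s₁ ℓ (D.prices (s.real 3 0) ℓ (s.nat 7 0)) := by
    intro ℓ hℓ
    rw [e3]
    exact (hA ℓ hℓ).congr (by rw [hf₁.nat 14 rfl]) (by rw [hf₁.real 8 rfl])
      fun k _ => by rw [hf₁.nat 13 rfl]
  refine ((runs_tryPrice h₁ (by rw [e8]; exact hpl) hA₁).seq
    (T' := D.n * (D.n * 60 + 220) + 110) fun s₂ hA₂ hf₂ => ?_).mono (by ring_nf; omega) fun _ h _ => h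
  rw [e3, e8, e4] at hA₂
  have h₂ := h₁.frame hf₂
  have e3₂ : s₂.real 3 = s.real 3 := by rw [hf₂.real 3 rfl, e3]
  have e7₂ : s₂.nat 7 = s.nat 7 := by rw [hf₂.nat 7 rfl, e7]
  have e8₂ : s₂.nat 8 0 = D.part (s.nat 7 0) := by rw [hf₂.nat 8 rfl, e8]
  refine (Runs.seq (T := 29) (T' := D.n * (D.n * 60 + 220) + 80)
    (Q' := fun s₃ => s₃.real 4 0 = D.c (s.nat 7 0) + max 0 (D.d (s.nat 7 0) - s.real 3 0))
    (Runs.of_wp ?_ (by decide)) fun s₃ e4₃ hf₃ => ?_).mono (by omega) fun _ h _ => h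
  · simp only [Program.wp, Test.Holds, NatExpr.eval, RealExpr.eval, natVar, realVar, e3₂, e7₂,
      h₂.c, h₂.d, writeReal_real, reduceIte]
    exact ⟨fun hb => by rw [max_eq_right hb],
      fun hb => by rw [max_eq_left (not_le.1 hb).le, add_zero]⟩
  · have h₃ := h₂.frame hf₃
    have e3₃ : s₃.real 3 = s.real 3 := by rw [hf₃.real 3 rfl, e3₂]
    have e8₃ : s₃.nat 8 0 = D.part (s.nat 7 0) := by rw [hf₃.nat 8 rfl, e8₂]
    refine (runs_tryPrice h₃ (by rw [e8₃]; exact hpl) (A := fun ℓ => if ℓ = D.part (s.nat 7 0) then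
      insert (D.c (s.nat 7 0)) (D.prices (s.real 3 0) ℓ (s.nat 7 0))
      else D.prices (s.real 3 0) ℓ (s.nat 7 0)) fun ℓ hℓ => ?_).mono le_rfl ?_
    · rw [e3₃]
      exact (hA₂ ℓ hℓ).congr (by rw [hf₃.nat 14 rfl]) (by rw [hf₃.real 8 rfl])
        fun k _ => by rw [hf₃.nat 13 rfl]
    · intro s₄ hA₄ _ ℓ hℓ
      have := hA₄ ℓ hℓ
      rw [e3₃, e8₃, e4₃] at this
      refine this.mono ?_
      rintro a ⟨k, hk, hkl, ha⟩
      rcases Nat.lt_succ_iff_lt_or_eq.1 hk with hk | rfl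
      · have : a ∈ D.prices (s.real 3 0) ℓ (s.nat 7 0) := ⟨k, hk, hkl, ha⟩
        split_ifs
        · exact .inr (.inr this)
        · exact this
      · rw [if_pos hkl.symm, if_pos hkl.symm]
        rcases ha with rfl | rfl
        · exact .inr (.inl rfl)
        · exact .inl rfl

end RAM

namespace RAM

open Data

variable {D : Data} {s : Store}

/-- The term `γ * q` takes `γ` additions, hence the assumption that the budget has been cut at `n`.
-/
theorem runs_solvePrice (hV : D.Valid) (h : D.In s) (hγ : s.nat 4 0 ≤ D.n) :
    Runs solvePrice s (1000 * (D.n + 1) ^ 3) fun s' => D.Feasible (s'.nat 13) ∧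
      (∃ a, s'.real 9 0 = D.value (s.nat 4 0) (s.real 3 0) a (s'.nat 13)) ∧
      ∀ a, (∀ ℓ < D.L, a ℓ ∈ D.prices (s.real 3 0) ℓ D.n) → ∀ x, D.Feasible x →
        s'.real 9 0 ≤ D.value (s.nat 4 0) (s.real 3 0) a x := by
  have clear : Runs (forLoop 10 sizeExpr (.setNat 14 (natVar 10) (.const 0))) s (D.n * 17 + 10)
      fun s' => ∀ k < D.n, s'.nat 14 k = 0 := by
    refine (Runs.forLoop (N := D.n) (T := 4) (fun i s' => ∀ k < i, s'.nat 14 k = 0) rfl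
      (by intro s' hf; exact (h.frame hf).n) (by simp) fun k hk s' hi hc hf => ?_).mono
      (by simp [NatExpr.cost, sizeExpr]) fun _ h _ => h
    refine Runs.of_wp ?_ (by decide)
    simp only [Program.wp, NatExpr.eval, natVar, writeNat_nat, hc, reduceIte, Nat.reduceEqDiff]
    grind
  refine (clear.seq (T' := D.n * (D.n * (D.n * 120 + 440) + 300) + 100) fun s₁ h14 hf₁ => ?_).mono
    (by nlinarith [sq_nonneg (D.n : ℤ)]) fun _ h _ => h
  have h₁ := h.frame hf₁
  have items : Runs (forLoop 7 sizeExpr tryItem) s₁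
      (D.n * (D.n * (D.n * 120 + 440) + 220 + 13) + 10) fun s' =>
      ∀ ℓ < D.L, D.Tried (s.real 3 0) s' ℓ (D.prices (s.real 3 0) ℓ D.n) := by
    refine (Runs.forLoop (N := D.n) (T := D.n * (D.n * 120 + 440) + 220)
      (fun i s' => ∀ ℓ < D.L, D.Tried (s.real 3 0) s' ℓ (D.prices (s.real 3 0) ℓ i)) rfl
      (by intro s' hf; exact (h₁.frame hf).n) (fun ℓ hℓ => .inl ⟨?_, ?_⟩)
      fun i hi s' hT hc hf => ?_).mono (by simp [NatExpr.cost, sizeExpr]) fun _ h _ => h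
    -- Clearing the first `n` flags reaches every set because `L ≤ n`.
    · rw [writeNat_nat, if_neg (by decide), h14 ℓ (hℓ.trans_le hV.le_size)]
    · simp [prices]
    · have e3 : s'.real 3 = s.real 3 := by rw [hf.real 3 rfl, hf₁.real 3 rfl]
      have := runs_tryItem hV (h₁.frame hf) (by rw [hc]; exact hi) (by rw [e3, hc]; exact hT)
      rw [e3, hc] at this
      refine this.mono le_rfl fun s'' hT' _ ℓ hℓ => (hT' ℓ hℓ).congr ?_ rfl fun k _ => ?_
      · rw [writeNat_nat, if_neg (by decide)]
      · rw [writeNat_nat, if_neg (by decide)]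
  refine (items.seq (T' := D.n * 50 + 50) fun s₂ hT hf₂ => ?_).mono
    (by ring_nf; omega) fun _ h _ => h
  have h₂ := h₁.frame hf₂
  refine (Runs.seq_of_wp (T := D.n * 50 + 40) fun hf₃ => ?_).mono
    (by simp [Program.steps, NatExpr.cost, RealExpr.cost]; omega) fun _ h _ => h
  have h₃ := h₂.frame hf₃
  simp only [NatExpr.eval, RealExpr.eval] at hf₃ h₃ ⊢
  generalize hs₃ : Store.writeReal _ _ _ _ = s₃ at *
  have e4 : s₃.nat 4 = s.nat 4 := by rw [hf₃.nat 4 rfl, hf₂.nat 4 rfl, hf₁.nat 4 rfl]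
  have e3 : s₃.real 3 = s.real 3 := by rw [hf₃.real 3 rfl, hf₂.real 3 rfl, hf₁.real 3 rfl]
  have budget : Runs (forLoop 10 (natVar 4) (.setReal 9 (.const 0) (.add (realVar 9) (realVar 3))))
      s₃ (D.n * 20 + 10) fun s' => s'.real 9 0 = s.nat 4 0 * s.real 3 0 := by
    refine (Runs.forLoop (N := s.nat 4 0) (T := 7)
      (fun i s' => s'.real 9 0 = i * s.real 3 0) rfl ?_ ?_ fun k hk s' hi hc hf => ?_).mono
      (by simp [NatExpr.cost, natVar]; omega) fun _ h _ => h
    · intro s' hf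
      simp only [NatExpr.eval, natVar, hf.nat 4 rfl, e4]
    · rw [← hs₃]; simp [writeNat_real, writeReal_real]
    · refine Runs.of_wp ?_ (by decide)
      simp only [Program.wp, NatExpr.eval, RealExpr.eval, realVar, writeReal_real, writeNat_real,
        reduceIte, hi, hf.real 3 rfl, e3]
      push_cast; ring
  refine (budget.seq (T' := D.n * 25 + 20) fun s₄ h9 hf₄ => ?_).mono (by omega) fun _ h _ => h
  have h₄ := h₃.frame hf₄
  refine (Runs.forLoop (N := D.L) (T := 3 + 2 + 3) (fun i s' => s'.real 9 0 =
    s.nat 4 0 * s.real 3 0 + ∑ ℓ ∈ Finset.range i, s₂.real 8 ℓ) rfl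
    ?_ ?_ fun k hk s' hi hc hf => ?_).mono ?_ ?_
  · intro s' hf
    exact (h₄.frame hf).L
  · simpa [writeNat_real] using h9
  · have e8 : s'.real 8 = s₂.real 8 := by rw [hf.real 8 rfl, hf₄.real 8 rfl, hf₃.real 8 rfl]
    refine Runs.of_wp ?_ (by decide)
    simp only [Program.wp, NatExpr.eval, RealExpr.eval, realVar, natVar, writeReal_real,
      writeNat_real, reduceIte, hi, hc, e8, Finset.sum_range_succ]
    ring
  · have := hV.le_size
    simp [NatExpr.cost]; omega
  · intro s₅ h9₅ hf₅
    have e13 : s₅.nat 13 = s₂.nat 13 := by rw [hf₅.nat 13 rfl, hf₄.nat 13 rfl, hf₃.nat 13 rfl]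
    rw [e13, h9₅]
    have hT' : ∀ ℓ, ∃ a, ℓ < D.L → D.IsSelection ℓ (s₂.nat 13) ∧
        s₂.real 8 ℓ = D.groupValue (s.real 3 0) ℓ a (s₂.nat 13) ∧
        ∀ a ∈ D.prices (s.real 3 0) ℓ D.n, ∀ x, D.IsSelection ℓ x →
          s₂.real 8 ℓ ≤ D.groupValue (s.real 3 0) ℓ a x := by
      intro ℓ
      by_cases hℓ : ℓ < D.L
      · rcases hT ℓ hℓ with ⟨-, he⟩ | ⟨-, hsel, ⟨a, ha⟩, hle⟩
        -- A nonempty set has at least one candidate price, so its flag has been raised.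
        · obtain ⟨k, hk, hkl⟩ := hV.part_surj ℓ hℓ
          have : D.c k ∈ D.prices (s.real 3 0) ℓ D.n := ⟨k, hk, hkl, .inl rfl⟩
          rw [he] at this
          exact absurd this (Set.notMem_empty _)
        · exact ⟨a, fun _ => ⟨hsel, ha, hle⟩⟩
      · exact ⟨0, fun h => absurd h hℓ⟩
    choose a ha using hT'
    refine ⟨fun ℓ hℓ => (ha ℓ hℓ).1, ⟨a, ?_⟩, fun a' ha' x hx => ?_⟩
    · rw [value, Finset.sum_congr rfl fun ℓ hℓ => (ha ℓ (Finset.mem_range.1 hℓ)).2.1]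
    · rw [value]
      gcongr with ℓ hℓ
      rw [Finset.mem_range] at hℓ
      exact (ha ℓ hℓ).2.2 _ (ha' ℓ hℓ) x (hx ℓ hℓ)

theorem runs_output (h : D.In s) :
    Runs output s (D.n * 20 + 20) fun s' =>
      s'.real 2 0 = s.real 9 0 ∧ ∀ k < D.n, s'.nat 3 k = s.nat 13 k := by
  refine (Runs.seq_of_wp (T := D.n * 20 + 10) fun hf₁ => ?_).mono
    (by simp [Program.steps, NatExpr.cost, RealExpr.cost, realVar]; omega) fun _ h _ => h
  have h₁ := h.frame hf₁
  refine (Runs.forLoop (N := D.n) (T := 7) (fun i s' => ∀ k < i, s'.nat 3 k = s.nat 13 k) rfl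
    (by intro s' hf; exact (h₁.frame hf).n) (by simp) fun k hk s' hi hc hf => ?_).mono
    (by simp [NatExpr.cost, sizeExpr]) ?_
  · have e13 : s'.nat 13 = s.nat 13 := by rw [hf.nat 13 rfl, hf₁.nat 13 rfl]
    refine Runs.of_wp ?_ (by decide)
    simp only [Program.wp, NatExpr.eval, natVar, writeNat_nat, hc, reduceIte, Nat.reduceEqDiff, e13]
    grind
  · intro s' hi hf
    refine ⟨?_, hi⟩
    rw [hf.real 2 rfl]
    simp [writeReal_real, NatExpr.eval, RealExpr.eval, realVar]

/-! ### Search over the budget prices -/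

/-- Compute the price of the budget that the current pair of items defines. -/
def setBudgetPrice : Program :=
  .branch (.realLe .zero (.sub (.add (.load 1 (natVar 5)) (.load 0 (natVar 5)))
      (.load 0 (natVar 6))))
    (.setReal 3 (.const 0) (.sub (.add (.load 1 (natVar 5)) (.load 0 (natVar 5)))
      (.load 0 (natVar 6))))
    (.setReal 3 (.const 0) .zero)

/-- Try the price of the budget that the current pair of items defines. -/
def tryPair : Program :=
  .seq setBudgetPrice
    (.seq solvePrice (.branch (.realLe (realVar 2) (realVar 9)) .skip output))

/-- Initialize with the effective budget and the solution for the price `0` of the budget. -/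
def startSearch : Program :=
  .seq (.seq (.branch (.natLe (.load 0 (.const 2)) sizeExpr)
      (.setNat 4 (.const 0) (.load 0 (.const 2))) (.setNat 4 (.const 0) sizeExpr))
    (.setReal 3 (.const 0) .zero))
  (.seq solvePrice output)

/-- Solve the min-max regret problem. -/
def solveMinMaxRegret : Program :=
  .seq startSearch (forLoop 5 sizeExpr (forLoop 6 sizeExpr tryPair))

namespace Data

/-- The output is at least as good as all solutions for the budget prices in `P`. -/
def Best (D : Data) (γ : ℕ) (s : Store) (P : Set ℝ) : Prop :=
  D.Feasible (s.nat 3) ∧ (∃ q a, 0 ≤ q ∧ s.real 2 0 = D.value γ q a (s.nat 3)) ∧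
    ∀ q ∈ P, ∀ a, (∀ ℓ < D.L, a ℓ ∈ D.prices q ℓ D.n) → ∀ x, D.Feasible x →
      s.real 2 0 ≤ D.value γ q a x

theorem feasible_congr {x y : ℕ → ℕ} (h : ∀ k < D.n, x k = y k) :
    D.Feasible x ↔ D.Feasible y :=
  forall₂_congr fun _ _ => isSelection_congr fun k hk => h k (mem_group.1 hk).1

theorem value_congr {γ : ℕ} {q : ℝ} {a : ℕ → ℝ} {x y : ℕ → ℕ} (h : ∀ k < D.n, x k = y k) :
    D.value γ q a x = D.value γ q a y := by
  rw [value, value, Finset.sum_congr rfl fun ℓ _ =>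
    groupValue_congr fun k hk => h k (mem_group.1 hk).1]

theorem Best.mono {γ : ℕ} {P R : Set ℝ} (h : D.Best γ s P) (hR : R ⊆ P) : D.Best γ s R :=
  ⟨h.1, h.2.1, fun q hq => h.2.2 q (hR hq)⟩

theorem Best.congr {γ : ℕ} {P : Set ℝ} {s' : Store} (h : D.Best γ s P)
    (h3 : s'.nat 3 = s.nat 3) (h2 : s'.real 2 = s.real 2) : D.Best γ s' P := by
  simpa only [Best, h3, h2] using h

end Data

theorem runs_tryPair (hV : D.Valid) (h : D.In s) (hγ : s.nat 4 0 ≤ D.n) {P : Set ℝ}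
    (hP : D.Best (s.nat 4 0) s P) :
    Runs tryPair s (1100 * (D.n + 1) ^ 3) fun s' => D.Best (s.nat 4 0) s'
      (insert (max 0 (D.d (s.nat 5 0) + D.c (s.nat 5 0) - D.c (s.nat 6 0))) P) := by
  have hn : D.n + 1 ≤ (D.n + 1) ^ 3 := Nat.le_self_pow (by decide) _
  refine (Runs.seq (T := 30) (T' := 1000 * (D.n + 1) ^ 3 + D.n * 20 + 40)
    (Q' := fun s₁ =>
      s₁.real 3 0 = max 0 (D.d (s.nat 5 0) + D.c (s.nat 5 0) - D.c (s.nat 6 0)))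
    (Runs.of_wp ?_ (by decide)) fun s₁ e3 hf₁ => ?_).mono (by omega) fun _ h _ => h
  · simp only [setBudgetPrice, Program.wp, Test.Holds, NatExpr.eval, RealExpr.eval, natVar, h.c,
      h.d, writeReal_real, reduceIte]
    exact ⟨fun hb => by rw [max_eq_right hb], fun hb => by rw [max_eq_left (not_le.1 hb).le]⟩
  have h₁ := h.frame hf₁
  have e4 : s₁.nat 4 = s.nat 4 := hf₁.nat 4 rfl
  have hsolve := runs_solvePrice hV h₁ (by rw [e4]; exact hγ)
  rw [e4, e3] at hsolve
  refine (hsolve.seq (T' := D.n * 20 + 40) fun s₂ ⟨hfeas, ⟨a, ha⟩, hle⟩ hf₂ => ?_).mono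
    (by omega) fun _ h _ => h
  have h₂ := h₁.frame hf₂
  have e2 : s₂.real 2 = s.real 2 := by rw [hf₂.real 2 rfl, hf₁.real 2 rfl]
  have e3' : s₂.nat 3 = s.nat 3 := by rw [hf₂.nat 3 rfl, hf₁.nat 3 rfl]
  refine (Runs.branch (T := D.n * 20 + 20) (fun hb => ?_) fun hb => ?_).mono
    (by simp [Test.cost, NatExpr.cost, RealExpr.cost, realVar]; omega) fun _ h _ => h
  · refine Runs.of_wp ?_ (by simp only [Program.steps]; omega)
    simp only [Test.Holds, RealExpr.eval, NatExpr.eval, realVar, e2] at hb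
    have hP₂ := hP.congr e3' e2
    refine ⟨hP₂.1, hP₂.2.1, ?_⟩
    rintro q (rfl | hq) a' ha' x hx
    · rw [e2]; exact hb.trans (hle a' ha' x hx)
    · exact hP₂.2.2 q hq a' ha' x hx
  · simp only [Test.Holds, RealExpr.eval, NatExpr.eval, realVar, e2] at hb
    refine (runs_output h₂).mono le_rfl fun s₃ ⟨h2, h3⟩ _ => ?_
    refine ⟨(feasible_congr h3).2 hfeas,
      ⟨_, a, le_max_left _ _, by rw [value_congr h3, h2, ha]⟩, ?_⟩
    rw [h2]
    rintro q (rfl | hq) a' ha' x hx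
    · exact hle a' ha' x hx
    · exact (not_le.1 hb).le.trans (hP.2.2 q hq a' ha' x hx)

/-- Solving for the price `0` first gives the search a genuine incumbent, so no infinite initial
value is needed. -/
theorem runs_startSearch (hV : D.Valid) (h : D.In s) :
    Runs startSearch s (1100 * (D.n + 1) ^ 3) fun s' =>
      s'.nat 4 0 = min (s.nat 0 2) D.n ∧ D.Best (min (s.nat 0 2) D.n) s' {0} := by
  have hn : D.n + 1 ≤ (D.n + 1) ^ 3 := Nat.le_self_pow (by decide) _
  refine (Runs.seq (T := 30) (T' := 1000 * (D.n + 1) ^ 3 + D.n * 20 + 20)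
    (Q' := fun s₁ => s₁.nat 4 0 = min (s.nat 0 2) D.n ∧ s₁.real 3 0 = 0)
    (Runs.of_wp ?_ (by decide)) fun s₁ ⟨e4, e3⟩ hf₁ => ?_).mono (by omega) fun _ h _ => h
  · simp only [Program.wp, Test.Holds, NatExpr.eval, RealExpr.eval, sizeExpr, h.n, writeNat_nat,
      writeReal_nat, writeReal_real, reduceIte]
    exact ⟨fun hb => by simp [hb], fun hb => by simp [(not_le.1 hb).le]⟩
  have h₁ := h.frame hf₁
  have hsolve := runs_solvePrice hV h₁ (by rw [e4]; exact min_le_right _ _)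
  rw [e4, e3] at hsolve
  refine (hsolve.seq (T' := D.n * 20 + 20) fun s₂ ⟨hfeas, ⟨a, ha⟩, hle⟩ hf₂ => ?_).mono
    (by omega) fun _ h _ => h
  refine (runs_output (h₁.frame hf₂)).mono le_rfl fun s₃ ⟨h2, h3⟩ hf₃ => ⟨?_, ?_⟩
  · rw [hf₃.nat 4 rfl, hf₂.nat 4 rfl, e4]
  · refine ⟨(feasible_congr h3).2 hfeas, ⟨0, a, le_rfl, by rw [value_congr h3, h2, ha]⟩, ?_⟩
    rw [h2]
    rintro q rfl a' ha' x hx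
    exact hle a' ha' x hx

theorem runs_solveMinMaxRegret (hV : D.Valid) (h : D.In s) :
    Runs solveMinMaxRegret s (3000 * (D.n + 1) ^ 5) fun s' =>
      D.Best (min (s.nat 0 2) D.n) s'
        {q | q = 0 ∨ ∃ i < D.n, ∃ j < D.n, q = max 0 (D.d i + D.c i - D.c j)} := by
  set γ := min (s.nat 0 2) D.n with hγ
  refine ((runs_startSearch hV h).seq
    (T' := D.n * (D.n * (1100 * (D.n + 1) ^ 3 + 13) + 10 + 13) + 10)
    fun s₁ ⟨e4, hbest⟩ hf₁ => ?_).mono ?_ fun _ h _ => h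
  swap
  · have h1 : 1 ≤ (D.n + 1) ^ 3 := Nat.one_le_pow _ _ (by omega)
    -- With `M = (n + 1)^3` factored out, the bound is linear in `M` and needs only `1 ≤ M`.
    have h2 : (D.n + 1) ^ 5 = (D.n + 1) ^ 3 * (D.n * D.n + 2 * D.n + 1) := by ring
    rw [h2]
    generalize (D.n + 1) ^ 3 = M at *
    nlinarith [Nat.zero_le (D.n * D.n * (M - 1)), Nat.zero_le (D.n * D.n),
      Nat.mul_le_mul_left D.n h1, Nat.mul_le_mul_left (D.n * D.n) h1]
  have h₁ := h.frame hf₁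
  refine (Runs.forLoop (N := D.n) (T := D.n * (1100 * (D.n + 1) ^ 3 + 13) + 10)
    (fun i s' => D.Best γ s' {q | q = 0 ∨ ∃ i' < i, ∃ j < D.n,
      q = max 0 (D.d i' + D.c i' - D.c j)}) rfl (by intro s' hf; exact (h₁.frame hf).n)
      ?_ fun i hi s₂ hb₂ hc₂ hf₂ => ?_).mono (by simp [NatExpr.cost, sizeExpr]) fun _ h _ => h
  · refine Best.mono (Best.congr hbest ?_ rfl) ?_
    · funext j; rw [writeNat_nat, if_neg (by decide)]
    · rintro q (rfl | ⟨i', hi', -⟩)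
      · rfl
      · omega
  have h₂ := h₁.frame hf₂
  have e4₂ : s₂.nat 4 0 = γ := by rw [hf₂.nat 4 rfl, e4]
  refine (Runs.forLoop (N := D.n) (T := 1100 * (D.n + 1) ^ 3)
    (fun j s' => D.Best γ s' {q | (q = 0 ∨ ∃ i' < i, ∃ j < D.n,
        q = max 0 (D.d i' + D.c i' - D.c j)) ∨
      ∃ j' < j, q = max 0 (D.d i + D.c i - D.c j')}) rfl
      (by intro s' hf; exact (h₂.frame hf).n)
      ?_ fun j hj s₃ hb₃ hc₃ hf₃ => ?_).mono (by simp [NatExpr.cost, sizeExpr]) ?_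
  · refine Best.mono (Best.congr hb₂ ?_ rfl) ?_
    · funext j; rw [writeNat_nat, if_neg (by decide)]
    · rintro q (hq | ⟨j', hj', -⟩)
      · exact hq
      · omega
  · have h₃ := h₂.frame hf₃
    have e4₃ : s₃.nat 4 0 = γ := by rw [hf₃.nat 4 rfl, e4₂]
    have e5₃ : s₃.nat 5 0 = i := by rw [hf₃.nat 5 rfl, hc₂]
    have := runs_tryPair hV h₃ (by rw [e4₃]; exact min_le_right _ _) (by rw [e4₃]; exact hb₃)
    rw [e4₃, e5₃, hc₃] at this
    refine this.mono le_rfl fun s₄ hb₄ _ => Best.mono (Best.congr hb₄ ?_ rfl) ?_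
    · funext j; rw [writeNat_nat, if_neg (by decide)]
    · rintro q (hq | ⟨j', hj', hq⟩)
      · exact .inr (.inl hq)
      · rcases Nat.lt_succ_iff_lt_or_eq.1 hj' with hj' | rfl
        · exact .inr (.inr ⟨j', hj', hq⟩)
        · exact .inl hq
  · refine fun s₄ hb₄ _ => Best.mono (Best.congr hb₄ ?_ rfl) ?_
    · funext j; rw [writeNat_nat, if_neg (by decide)]
    · rintro q (hq | ⟨i', hi', j, hj, hq⟩)
      · exact .inl (.inl hq)
      · rcases Nat.lt_succ_iff_lt_or_eq.1 hi' with hi' | rfl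
        · exact .inl (.inr ⟨i', hi', j, hj, hq⟩)
        · exact .inr ⟨j, hj, hq⟩

end RAM

/-! ### Translation between instances and the data of the program -/

namespace SelectionInstance

variable {n : ℕ} (I : SelectionInstance n)

/-- The instance as data of the program. -/
noncomputable def data : RAM.Data where
  n := n
  L := I.L
  part := I.input.nat 1
  p := I.input.nat 2
  c := I.input.real 0
  d := I.input.real 1

theorem data_n : I.data.n = n := rfl

theorem data_L : I.data.L = I.L := rfl

theorem data_in : I.data.In I.input :=
  ⟨by simp [input, data], by simp [input, data], rfl, rfl, rfl, rfl⟩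

theorem data_part (i : Fin n) : I.data.part i = I.part i := by simp [data, input]

theorem data_p (ℓ : Fin I.L) : I.data.p ℓ = I.p ℓ := by simp [data, input]

theorem data_c (i : Fin n) : I.data.c i = I.base i := by simp [data, input]

theorem data_d (i : Fin n) : I.data.d i = I.dev i := by simp [data, input]

theorem sum_data_group {M : Type*} [AddCommMonoid M] (f : ℕ → M) (ℓ : Fin I.L) :
    ∑ k ∈ I.data.group ℓ, f k = ∑ i ∈ I.T ℓ, f i := by
  rw [RAM.Data.group, T, Finset.sum_filter, Finset.sum_filter, data_n]
  refine (Finset.sum_range _).trans (Finset.sum_congr rfl fun i _ => ?_)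
  have : I.data.part i = ℓ ↔ I.part i = ℓ := by rw [data_part, Fin.ext_iff]
  exact if_congr this rfl rfl

theorem data_valid : I.data.Valid where
  part_lt k hk := by
    rw [show k = ((⟨k, hk⟩ : Fin n) : ℕ) from rfl, data_part]
    exact Fin.is_lt _
  le_size := by simpa [data_n, data_L] using Fintype.card_le_of_surjective _ I.part_surjective
  p_le ℓ hℓ := by
    lift ℓ to Fin I.L using hℓ
    rw [data_p, Finset.card_eq_sum_ones, sum_data_group, ← Finset.card_eq_sum_ones]
    exact I.p_le ℓ
  part_surj ℓ hℓ := by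
    lift ℓ to Fin I.L using hℓ
    obtain ⟨i, hi⟩ := I.part_surjective ℓ
    exact ⟨i, i.2, by rw [data_part, hi]⟩

theorem le_one_of_feasible {x : ℕ → ℕ} (hx : I.data.Feasible x) (i : Fin n) : x i ≤ 1 :=
  (hx (I.part i) (I.part i).2).1 i (RAM.mem_group.2 ⟨i.2, I.data_part i⟩)

theorem feasible_cast_iff {x : ℕ → ℕ} :
    (fun i : Fin n => (x i : ℝ)) ∈ I.feasible ↔ I.data.Feasible x := by
  constructor
  · rintro ⟨h1, h2⟩ ℓ hℓ
    lift ℓ to Fin I.L using hℓ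
    refine ⟨fun k hk => ?_, ?_⟩
    · have hk : k < n := (RAM.mem_group.1 hk).1
      have := h1 ⟨k, hk⟩
      simp only [Nat.cast_eq_zero, Nat.cast_eq_one] at this
      omega
    · rw [sum_data_group, data_p]
      have := h2 ℓ
      simp only at this
      exact_mod_cast this
  · intro h
    refine ⟨fun i => ?_, fun ℓ => ?_⟩
    · have := I.le_one_of_feasible h i
      simp only [Nat.cast_eq_zero, Nat.cast_eq_one]
      omega
    · have := (h ℓ ℓ.2).2
      rw [sum_data_group, data_p] at this
      simp only
      exact_mod_cast this

theorem exists_cast_eq {z : Fin n → ℝ} (hz : z ∈ I.feasible) :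
    ∃ x : ℕ → ℕ, (fun i : Fin n => (x i : ℝ)) = z := by
  refine ⟨fun k => if h : k < n then if z ⟨k, h⟩ = 1 then 1 else 0 else 0, ?_⟩
  funext i
  rcases hz.1 i with h | h <;> simp [h]

/-- The items are regrouped by sets. For `x i ∈ {0, 1}` the share of an item in the dual value is
affine in `x i` with slope `key`, which is checked at both values. -/
theorem data_value (q : ℝ) (a : ℕ → ℝ) {x : ℕ → ℕ} (hx : I.data.Feasible x) :
    I.data.value I.effBudget q a x = I.dualValue q (fun ℓ => a ℓ) fun i => x i := by
  rw [RAM.Data.value, dualValue, add_sub_assoc, data_L]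
  congr 1
  refine (Finset.sum_range _).trans ?_
  rw [← Finset.sum_fiberwise Finset.univ I.part, ← Finset.sum_sub_distrib]
  refine Finset.sum_congr rfl fun ℓ _ => ?_
  rw [RAM.Data.groupValue, ← Finset.sum_add_distrib, sum_data_group, data_p]
  congr 1
  refine Finset.sum_congr rfl fun i hi => ?_
  rw [(Finset.mem_filter.1 hi).2, RAM.Data.key, data_c, data_d]
  have := I.le_one_of_feasible hx i
  interval_cases x i
  · simp
  · simp

end SelectionInstance

theorem mainTheorem3 :
    ∃ (P : RAM.Program) (time : ℕ → ℕ),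
      ((fun n : ℕ => (time n : ℝ)) =O[atTop] fun n : ℕ => (n : ℝ) ^ 5) ∧
      ∀ (n : ℕ) (I : SelectionInstance n), ∃ (s : RAM.Store) (t : ℕ),
        RAM.Exec P I.input s t ∧ t ≤ time n ∧
        I.IsMinMaxRegret (outputSolution n s) (outputValue s) := by
  -- The bound must also hold for `n = 0`, hence `n + 1`; for `n ≥ 1` it is at most `2n`, which
  -- gives the constant `3000 * 2 ^ 5`.
  refine ⟨RAM.solveMinMaxRegret, fun n => 3000 * (n + 1) ^ 5, ?_, fun n I => ?_⟩
  · refine IsBigO.of_bound (3000 * 2 ^ 5) ?_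
    filter_upwards [eventually_ge_atTop 1] with n hn
    have hn' : (1 : ℝ) ≤ n := by exact_mod_cast hn
    rw [Real.norm_of_nonneg (by positivity), Real.norm_of_nonneg (by positivity), mul_assoc,
      ← mul_pow]
    push_cast
    gcongr
    linarith
  · obtain ⟨s, t, hexec, ht, hfeas, ⟨q, a, hq, hval⟩, hbest⟩ :=
      RAM.runs_solveMinMaxRegret I.data_valid I.data_in
    have hγ : min (I.input.nat 0 2) I.data.n = I.effBudget := by
      simp [SelectionInstance.input, SelectionInstance.data, SelectionInstance.effBudget]
    rw [hγ] at hval hbest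
    refine ⟨s, t, hexec, ht, ?_⟩
    rw [outputValue, hval, I.data_value q a hfeas]
    refine I.isMinMaxRegret_of_forall_dualValue_le (I.feasible_cast_iff.2 hfeas) hq ?_
    intro q' hq' a' ha' z hz
    obtain ⟨x, rfl⟩ := I.exists_cast_eq hz
    have hx := I.feasible_cast_iff.1 hz
    -- The program's prices are indexed by all natural numbers; the value `0` beyond `L` is never
    -- used.
    have key := hbest q' ?_ (fun ℓ => if h : ℓ < I.L then a' ⟨ℓ, h⟩ else 0) (fun ℓ hℓ => ?_) x hx
    · rw [hval, I.data_value q a hfeas, I.data_value _ _ hx] at key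
      simp only [Fin.is_lt, dif_pos, Fin.eta] at key
      exact key
    · rcases hq' with h | ⟨i, j, h⟩
      · exact .inl h
      · exact .inr ⟨i, i.2, j, j.2, by rw [h, I.data_c, I.data_c, I.data_d]⟩
    · change ℓ < I.L at hℓ
      lift ℓ to Fin I.L using hℓ
      obtain ⟨i, hi, h⟩ := ha' ℓ
      refine ⟨i, i.2, by rw [I.data_part, hi], ?_⟩
      simpa [I.data_c, I.data_d] using h
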